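/- **Theorem 5.** Every regular fractal diagonal Peano curve that is similar to a unit Peano curve has square-to-linear ratio at least $5$. Here a curve is a continuous map $p:[a,b]\to\mathbb R^2$ with $a<b$. Two curves $f:[a,b]\to\mathbb R^2$ and $g:[c,d]\to\mathbb R^2$ are isometric if there are an isometry $h$ of the line with $h([a,b])=[c,d]$ and an isometry $h'$ of the plane with $h'\circ f=g\circ h$ on $[a,b]$; they are similar if for some $k>0$ the curve $t\mapsto\sqrt k\,f(t/k)$ on $[ka,kb]$ is isometric to $g$. A unit Peano curve is a curve that maps $[0,1]$ onto a square of side $1$. A fractal period of $p$ is a nondegenerate segment $[c,d]\subsetneq[a,b]$ such that $p|_{[c,d]}$ is similar to $p$; it is maximal if it is not contained in any other fractal period. The curve $p$ is fractal if every point of $[a,b]$ lies in a fractal period. It is a regular fractal Peano curve if it is fractal, its image is a square, and its maximal fractal periods form a regular partition of $[a,b]$, i.e. they are finitely many segments of equal length with pairwise disjoint interiors whose union is $[a,b]$. It is diagonal if $p(a)$ and $p(b)$ lie on one diagonal of the image square. The square-to-linear ratio of $p$ is $$\sup_{t\ne t'\in[a,b]}\frac{|p(t)-p(t')|^2}{|t-t'|}.$$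 -/

import Mathlib

open scoped ENNReal

noncomputable section

namespace PeanoCurve

/-- The Euclidean plane. -/
abbrev Plane : Type := EuclideanSpace ℝ (Fin 2)

/-- A (plane) curve: a continuous map of a nondegenerate time segment `[a, b]` into the plane.
The values of `toFun` outside `[a, b]` are never used. -/
structure Curve where
  a : ℝ
  b : ℝ
  a_lt_b : a < b
  toFun : ℝ → Plane
  continuousOn : ContinuousOn toFun (Set.Icc a b)

namespace Curve

/-- The domain `[a, b]` of a curve. -/
def domain (F : Curve) : Set ℝ := Set.Icc F.a F.b

/-- The image of a curve. -/
def image (F : Curve) : Set Plane := F.toFun '' F.domain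

/-- The restriction of a curve to a subsegment `[c, d]` of its domain. -/
def restrict (F : Curve) (c d : ℝ) (hac : F.a ≤ c) (hcd : c < d) (hdb : d ≤ F.b) : Curve where
  a := c
  b := d
  a_lt_b := hcd
  toFun := F.toFun
  continuousOn := F.continuousOn.mono (Set.Icc_subset_Icc hac hdb)

/-- The rescaled curve `t ↦ √k f(t / k)`, defined on `[k a, k b]`. -/
def rescale (F : Curve) (k : ℝ) (hk : 0 < k) : Curve where
  a := k * F.a
  b := k * F.b
  a_lt_b := mul_lt_mul_of_pos_left F.a_lt_b hk
  toFun := fun t => Real.sqrt k • F.toFun (t / k)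
  continuousOn := by
    refine ContinuousOn.const_smul (F.continuousOn.comp (by fun_prop) ?_) (Real.sqrt k)
    intro t ht
    exact ⟨(le_div_iff₀' hk).2 ht.1, (div_le_iff₀' hk).2 ht.2⟩

/-- Isometric curves: an isometry `h` of the line (possibly reversing time) takes one domain onto
the other, and an isometry `h'` of the plane satisfies `h' ∘ f = g ∘ h`. -/
def IsIsometric (F G : Curve) : Prop :=
  ∃ (h : ℝ ≃ᵢ ℝ) (h' : Plane ≃ᵢ Plane),
    h '' F.domain = G.domain ∧ ∀ t ∈ F.domain, h' (F.toFun t) = G.toFun (h t)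

/-- Similar curves: for some coefficient `k > 0` the curve `√k f(t / k)` is isometric to `g`. -/
def IsSimilar (F G : Curve) : Prop :=
  ∃ (k : ℝ) (hk : 0 < k), (F.rescale k hk).IsIsometric G

/-- `[c, d]` is a fractal period of `F`: the restriction of `F` to `[c, d]` is similar to `F`. -/
def IsPeriod (F : Curve) (c d : ℝ) : Prop :=
  ∃ (hac : F.a ≤ c) (hcd : c < d) (hdb : d ≤ F.b), F.IsSimilar (F.restrict c d hac hcd hdb)

/-- A fractal period different from the whole domain. -/
def IsProperPeriod (F : Curve) (c d : ℝ) : Prop :=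
  F.IsPeriod c d ∧ (c, d) ≠ (F.a, F.b)

/-- A maximal period: a (proper) period that is not contained in any other (proper) period. -/
def IsMaximalPeriod (F : Curve) (c d : ℝ) : Prop :=
  F.IsProperPeriod c d ∧
    ∀ c' d' : ℝ, F.IsProperPeriod c' d' → Set.Icc c d ⊆ Set.Icc c' d' → (c', d') = (c, d)

/-- A curve is fractal if every moment of its domain belongs to some (proper) fractal period. -/
def IsFractal (F : Curve) : Prop :=
  ∀ t ∈ F.domain, ∃ c d : ℝ, F.IsProperPeriod c d ∧ t ∈ Set.Icc c d

end Curve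

/-- A regular partition of `[a, b]`: finitely many segments of equal length, whose union is `[a, b]`
and whose interiors are pairwise disjoint. A segment `[c, d]` is given as the pair `(c, d)`. -/
def IsRegularPartition (P : Set (ℝ × ℝ)) (a b : ℝ) : Prop :=
  P.Finite ∧ (∃ l : ℝ, 0 < l ∧ ∀ I ∈ P, I.2 - I.1 = l) ∧
    (⋃ I ∈ P, Set.Icc I.1 I.2) = Set.Icc a b ∧
    P.Pairwise fun I J => Disjoint (Set.Ioo I.1 I.2) (Set.Ioo J.1 J.2)

/-- The coordinate square `[0, s] × [0, s]`. -/
def coordSquare (s : ℝ) : Set Plane := {x | ∀ i, x i ∈ Set.Icc 0 s}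

/-- The diagonal of `[0, s] × [0, s]` from `(0, 0)` to `(s, s)`. -/
def coordDiagonal (s : ℝ) : Set Plane := {x | x ∈ coordSquare s ∧ x 0 = x 1}

/-- `Q` is a closed square of side `s` in the plane, in arbitrary position. -/
def IsSquareOfSide (Q : Set Plane) (s : ℝ) : Prop :=
  0 < s ∧ ∃ φ : Plane ≃ᵢ Plane, Q = φ '' coordSquare s

/-- `D` is one of the two diagonals of the square `Q`. (Both occur, since the coordinate square has
a symmetry exchanging its diagonals.) -/
def IsDiagonalOf (D Q : Set Plane) : Prop :=
  ∃ (s : ℝ) (φ : Plane ≃ᵢ Plane), 0 < s ∧ Q = φ '' coordSquare s ∧ D = φ '' coordDiagonal s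

namespace Curve

/-- A regular (fractal) Peano curve: a fractal curve whose image is a square and whose maximal
periods form a regular partition of its domain. -/
def IsRegularPeano (F : Curve) : Prop :=
  F.IsFractal ∧ (∃ s : ℝ, IsSquareOfSide F.image s) ∧
    IsRegularPartition {I : ℝ × ℝ | F.IsMaximalPeriod I.1 I.2} F.a F.b

/-- A unit Peano curve: a curve mapping the unit segment onto a unit square. -/
def IsUnitPeano (F : Curve) : Prop :=
  F.a = 0 ∧ F.b = 1 ∧ IsSquareOfSide F.image 1

/-- The start and the end of the curve lie on a diagonal of the square that it fills. -/
def IsDiagonal (F : Curve) : Prop :=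
  ∃ D : Set Plane, IsDiagonalOf D F.image ∧ F.toFun F.a ∈ D ∧ F.toFun F.b ∈ D

/-- The square-to-linear ratio of a curve `p`: the supremum of `|p(t) - p(t')|² / |t - t'|` over all
pairs of distinct moments, as an extended nonnegative real. -/
def squareToLinearRatio (F : Curve) : ℝ≥0∞ :=
  ⨆ (t ∈ F.domain) (t' ∈ F.domain) (_ : t ≠ t'),
    ENNReal.ofReal (‖F.toFun t - F.toFun t'‖ ^ 2 / |t - t'|)

end Curve

end PeanoCurve

end

/-! Suppose the ratio is below 5. Being similar to a unit Peano curve makes the duration of the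
curve equal to the area of its square (`Curve.sq_side_eq`), so it normalizes to a map `p` of [0,1]
onto the unit square, still of ratio below 5, whose equal pieces are similar to `p`. Subdividing
repeatedly (`hasPiece_pow`) gives as many pieces M as desired. Their images are equal squares of
total area 1, hence form an m × m grid (`IsTiling.grid`). Junctions of pieces lie in two cells, so
both ends of `p` are on the boundary of the square. Since they also lie on a diagonal, they are
corners, and they are opposite (`IsPieceSystem.exists_corner`). Thus each piece crosses its cell
diagonally, and the junctions form a path of diagonal steps meeting every cell once.

The other two vertices of cell k are visited at relative moments w, z. Distances 1 to the ends and
√2 to each other give 1/5 < w, z < 4/5 and |w - z| > 2/5, so one moment exceeds 3/5 and the other is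
below 2/5. Which one is late is the label `X` or `Y`. If one coordinate moves monotonically for n
steps, the ratio bound on its total change n limits the labels in that run (`GridPath.run_bounds`):
its own label occurs at most once, occurs at neither end if n ≥ 4, and n ≥ 5 is impossible.

The rest is combinatorics. Call a step dead if both monotone runs through it have already used up
their label. Then the next label dictates which coordinate turns, and deadness persists
(`GridPath.Dead.step`). A dead path cannot pass one of the two corners where it does not end
(`GridPath.not_dead_of_corner`); by time reversal, it is not live shortly after such a corner, and a
path that is not live soon becomes dead. Both corners must be visited, far apart in a large grid: a
contradiction (`GridPath.not_covering`). -/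

/-- A path of diagonal steps on the integer points of the square `[0, m] × [0, m]` that passes
through each cell at most once, with a label `X` or `Y` at each step. -/
structure GridPath where
  m : ℤ
  M : ℕ
  x : ℕ → ℤ
  y : ℕ → ℤ
  X : ℕ → Prop
  Y : ℕ → Prop
  label : ∀ i, X i ∨ Y i
  not_both : ∀ i, X i → Y i → False
  step_x : ∀ i < M, x (i + 1) = x i + 1 ∨ x (i + 1) = x i - 1
  step_y : ∀ i < M, y (i + 1) = y i + 1 ∨ y (i + 1) = y i - 1
  mem_x : ∀ i ≤ M, 0 ≤ x i ∧ x i ≤ m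
  mem_y : ∀ i ≤ M, 0 ≤ y i ∧ y i ≤ m
  inj : ∀ i < M, ∀ j < M, x i + x (i + 1) = x j + x (j + 1) →
    y i + y (i + 1) = y j + y (j + 1) → i = j
  -- A run from step i to step j consists of j - i + 1 steps, so i + 3 ≤ j means at least four of
  -- them.
  run_x_two : ∀ i j, i < j → j < M → (∀ l, i ≤ l → l < j → x l + x (l + 2) = 2 * x (l + 1)) →
    X i → X j → False
  run_x_four : ∀ i j, i + 3 ≤ j → j < M →
    (∀ l, i ≤ l → l < j → x l + x (l + 2) = 2 * x (l + 1)) → X i ∨ X j → False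
  run_x_five : ∀ i j, i + 4 ≤ j → j < M →
    (∀ l, i ≤ l → l < j → x l + x (l + 2) = 2 * x (l + 1)) → False
  run_y_two : ∀ i j, i < j → j < M → (∀ l, i ≤ l → l < j → y l + y (l + 2) = 2 * y (l + 1)) →
    Y i → Y j → False
  run_y_four : ∀ i j, i + 3 ≤ j → j < M →
    (∀ l, i ≤ l → l < j → y l + y (l + 2) = 2 * y (l + 1)) → Y i ∨ Y j → False
  run_y_five : ∀ i j, i + 4 ≤ j → j < M →
    (∀ l, i ≤ l → l < j → y l + y (l + 2) = 2 * y (l + 1)) → False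

/-! ### Combinatorics of labelled diagonal grid paths. -/

namespace GridPath

/-- The steps from `i` to `j` of the sequence `u` are all equal. -/
def Run (u : ℕ → ℤ) (i j : ℕ) : Prop := ∀ l, i ≤ l → l < j → u l + u (l + 2) = 2 * u (l + 1)

lemma Run.refl (u : ℕ → ℤ) (i : ℕ) : Run u i i := fun l h1 h2 => by omega

lemma Run.succ {u : ℕ → ℤ} {i j : ℕ} (h : Run u i j) (hs : u j + u (j + 2) = 2 * u (j + 1)) :
    Run u i (j + 1) := by
  intro l h1 h2
  rcases Nat.lt_succ_iff_lt_or_eq.1 h2 with h3 | rfl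
  · exact h l h1 h3
  · exact hs

/-- The transposed path. -/
def swap (G : GridPath) : GridPath where
  m := G.m
  M := G.M
  x := G.y
  y := G.x
  X := G.Y
  Y := G.X
  label := fun i => (G.label i).symm
  not_both := fun i h h' => G.not_both i h' h
  step_x := G.step_y
  step_y := G.step_x
  mem_x := G.mem_y
  mem_y := G.mem_x
  inj := fun i hi j hj h h' => G.inj i hi j hj h' h
  run_x_two := G.run_y_two
  run_x_four := G.run_y_four
  run_x_five := G.run_y_five
  run_y_two := G.run_x_two
  run_y_four := G.run_x_four
  run_y_five := G.run_x_five

/-- The path reflected in the centre of the square. -/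
def reflect (G : GridPath) : GridPath where
  m := G.m
  M := G.M
  x := fun i => G.m - G.x i
  y := fun i => G.m - G.y i
  X := G.X
  Y := G.Y
  label := G.label
  not_both := G.not_both
  step_x := fun i hi => by have := G.step_x i hi; omega
  step_y := fun i hi => by have := G.step_y i hi; omega
  mem_x := fun i hi => by have := G.mem_x i hi; omega
  mem_y := fun i hi => by have := G.mem_y i hi; omega
  inj := fun i hi j hj h h' => G.inj i hi j hj (by omega) (by omega)
  run_x_two := fun i j h1 h2 h3 =>
    G.run_x_two i j h1 h2 fun l h4 h5 => by have := h3 l h4 h5; omega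
  run_x_four := fun i j h1 h2 h3 =>
    G.run_x_four i j h1 h2 fun l h4 h5 => by have := h3 l h4 h5; omega
  run_x_five := fun i j h1 h2 h3 =>
    G.run_x_five i j h1 h2 fun l h4 h5 => by have := h3 l h4 h5; omega
  run_y_two := fun i j h1 h2 h3 =>
    G.run_y_two i j h1 h2 fun l h4 h5 => by have := h3 l h4 h5; omega
  run_y_four := fun i j h1 h2 h3 =>
    G.run_y_four i j h1 h2 fun l h4 h5 => by have := h3 l h4 h5; omega
  run_y_five := fun i j h1 h2 h3 =>
    G.run_y_five i j h1 h2 fun l h4 h5 => by have := h3 l h4 h5; omega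

lemma run_rev {u : ℕ → ℤ} {M i j : ℕ} (hj : j < M)
    (h : Run (fun i => u (M - i)) i j) : Run u (M - 1 - j) (M - 1 - i) := by
  intro l h1 h2
  have := h (M - 2 - l) (by omega) (by omega)
  simp only at this
  rw [show M - (M - 2 - l) = l + 2 by omega, show M - (M - 2 - l + 2) = l by omega,
    show M - (M - 2 - l + 1) = l + 1 by omega] at this
  omega

/-- The path traversed backwards. -/
def rev (G : GridPath) : GridPath where
  m := G.m
  M := G.M
  x := fun i => G.x (G.M - i)
  y := fun i => G.y (G.M - i)
  X := fun i => G.X (G.M - 1 - i)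
  Y := fun i => G.Y (G.M - 1 - i)
  label := fun i => G.label _
  not_both := fun i => G.not_both _
  step_x := fun i hi => by
    have := G.step_x (G.M - (i + 1)) (by omega)
    rw [show G.M - (i + 1) + 1 = G.M - i by omega] at this
    omega
  step_y := fun i hi => by
    have := G.step_y (G.M - (i + 1)) (by omega)
    rw [show G.M - (i + 1) + 1 = G.M - i by omega] at this
    omega
  mem_x := fun i hi => G.mem_x _ (by omega)
  mem_y := fun i hi => G.mem_y _ (by omega)
  inj := fun i hi j hj h h' => by
    have := G.inj (G.M - (i + 1)) (by omega) (G.M - (j + 1)) (by omega)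
    rw [show G.M - (i + 1) + 1 = G.M - i by omega, show G.M - (j + 1) + 1 = G.M - j by omega] at this
    have := this (by omega) (by omega)
    omega
  run_x_two := fun i j h1 h2 h3 h4 h5 =>
    G.run_x_two (G.M - 1 - j) (G.M - 1 - i) (by omega) (by omega) (run_rev h2 h3) h5 h4
  run_x_four := fun i j h1 h2 h3 h4 =>
    G.run_x_four (G.M - 1 - j) (G.M - 1 - i) (by omega) (by omega) (run_rev h2 h3) h4.symm
  run_x_five := fun i j h1 h2 h3 =>
    G.run_x_five (G.M - 1 - j) (G.M - 1 - i) (by omega) (by omega) (run_rev h2 h3)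
  run_y_two := fun i j h1 h2 h3 h4 h5 =>
    G.run_y_two (G.M - 1 - j) (G.M - 1 - i) (by omega) (by omega) (run_rev h2 h3) h5 h4
  run_y_four := fun i j h1 h2 h3 h4 =>
    G.run_y_four (G.M - 1 - j) (G.M - 1 - i) (by omega) (by omega) (run_rev h2 h3) h4.symm
  run_y_five := fun i j h1 h2 h3 =>
    G.run_y_five (G.M - 1 - j) (G.M - 1 - i) (by omega) (by omega) (run_rev h2 h3)

/-- Both runs through the step `i` have met their label at or before `i`. -/
def Dead (G : GridPath) (i : ℕ) : Prop :=
  (∃ a ≤ i, G.X a ∧ Run G.x a i) ∧ (∃ b ≤ i, G.Y b ∧ Run G.y b i)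

/-- Both runs through the step `i` meet their label at or after `i`. -/
def Live (G : GridPath) (i : ℕ) : Prop :=
  (∃ a, i ≤ a ∧ a < G.M ∧ G.X a ∧ Run G.x i a) ∧ (∃ b, i ≤ b ∧ b < G.M ∧ G.Y b ∧ Run G.y i b)

variable (G : GridPath)

lemma Dead.swap {G : GridPath} {i : ℕ} (h : G.Dead i) : G.swap.Dead i := ⟨h.2, h.1⟩

lemma Dead.of_swap {G : GridPath} {i : ℕ} (h : G.swap.Dead i) : G.Dead i := ⟨h.2, h.1⟩

lemma Live.of_swap {G : GridPath} {i : ℕ} (h : G.swap.Live i) : G.Live i := ⟨h.2, h.1⟩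

lemma Dead.reflect {G : GridPath} {i : ℕ} (h : G.Dead i) : G.reflect.Dead i := by
  obtain ⟨⟨a, ha, hX, hx⟩, b, hb, hY, hy⟩ := h
  refine ⟨⟨a, ha, hX, fun l h1 h2 => ?_⟩, b, hb, hY, fun l h1 h2 => ?_⟩
  · have := hx l h1 h2
    simp only [GridPath.reflect]; omega
  · have := hy l h1 h2
    simp only [GridPath.reflect]; omega

lemma Live.rev {G : GridPath} {i : ℕ} (hi : i < G.M) (h : G.Live i) :
    G.rev.Dead (G.M - 1 - i) := by
  have key : ∀ (u : ℕ → ℤ) (a : ℕ), a < G.M → Run u i a →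
      Run (fun k => u (G.M - k)) (G.M - 1 - a) (G.M - 1 - i) := by
    intro u a ha hr l h1 h2
    have := hr (G.M - 2 - l) (by omega) (by omega)
    rw [show G.M - 2 - l + 2 = G.M - l by omega, show G.M - 2 - l + 1 = G.M - (l + 1) by omega,
      show G.M - 2 - l = G.M - (l + 2) by omega] at this
    simp only; omega
  obtain ⟨⟨a, ha, ha', hX, hx⟩, b, hb, hb', hY, hy⟩ := h
  refine ⟨⟨G.M - 1 - a, by omega, ?_, key _ a ha' hx⟩, G.M - 1 - b, by omega, ?_, key _ b hb' hy⟩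
  · simpa [GridPath.rev, show G.M - 1 - (G.M - 1 - a) = a by omega] using hX
  · simpa [GridPath.rev, show G.M - 1 - (G.M - 1 - b) = b by omega] using hY

lemma flip_or_straight_x {i : ℕ} (hi : i + 1 < G.M) :
    G.x (i + 2) = G.x i ∨ G.x i + G.x (i + 2) = 2 * G.x (i + 1) := by
  have h1 := G.step_x i (by omega)
  have h2 := G.step_x (i + 1) hi
  simp only [add_assoc, Nat.reduceAdd] at h2
  omega

lemma flip_or_straight_y {i : ℕ} (hi : i + 1 < G.M) :
    G.y (i + 2) = G.y i ∨ G.y i + G.y (i + 2) = 2 * G.y (i + 1) :=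
  G.swap.flip_or_straight_x hi

/-- Turning in both coordinates would retrace the same cell. -/
lemma not_both_flip {i : ℕ} (hi : i + 1 < G.M) (h : G.x (i + 2) = G.x i)
    (h' : G.y (i + 2) = G.y i) : False := by
  have := G.inj i (by omega) (i + 1) hi (by simp only [add_assoc, Nat.reduceAdd]; omega)
    (by simp only [add_assoc, Nat.reduceAdd]; omega)
  omega

/-- A label `X` on the next step forces x to turn, since otherwise its run would carry `X` twice;
then y must go straight and its run keeps its old `Y`. Symmetrically for `Y`. -/
lemma Dead.step {G : GridPath} {i : ℕ} (h : G.Dead i) (hi : i + 1 < G.M) :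
    (G.x (i + 2) = G.x i ∧ G.y i + G.y (i + 2) = 2 * G.y (i + 1) ∧ G.X (i + 1) ∨
      G.y (i + 2) = G.y i ∧ G.x i + G.x (i + 2) = 2 * G.x (i + 1) ∧ G.Y (i + 1)) ∧
    G.Dead (i + 1) := by
  obtain ⟨⟨a, ha, hX, hx⟩, b, hb, hY, hy⟩ := h
  rcases G.label (i + 1) with hl | hl
  · rcases G.flip_or_straight_x hi with h1 | h1
    · rcases G.flip_or_straight_y hi with h2 | h2
      · exact (G.not_both_flip hi h1 h2).elim
      · exact ⟨Or.inl ⟨h1, h2, hl⟩, ⟨i + 1, le_rfl, hl, Run.refl _ _⟩, b, by omega, hY, hy.succ h2⟩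
    · exact (G.run_x_two a (i + 1) (by omega) hi (hx.succ h1) hX hl).elim
  · rcases G.flip_or_straight_y hi with h1 | h1
    · rcases G.flip_or_straight_x hi with h2 | h2
      · exact (G.not_both_flip hi h2 h1).elim
      · exact ⟨Or.inr ⟨h1, h2, hl⟩, ⟨a, by omega, hX, hx.succ h2⟩, i + 1, le_rfl, hl, Run.refl _ _⟩
    · exact (G.run_y_two b (i + 1) (by omega) hi (hy.succ h1) hY hl).elim

lemma Dead.mono {G : GridPath} {i j : ℕ} (h : G.Dead i) (hij : i ≤ j) (hj : j < G.M) :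
    G.Dead j := by
  induction j, hij using Nat.le_induction with
  | base => exact h
  | succ n hn ih => exact ((ih (by omega)).step hj).2

/-- After a dead step the path cannot run into the corner of the square. -/
lemma not_dead_of_corner {k : ℕ} (hk : k + 6 < G.M) (h1 : G.x (k + 3) = G.m - 1)
    (h2 : G.y (k + 3) = 0) (h3 : G.x (k + 4) = G.m) (h4 : G.y (k + 4) = 1) : ¬ G.Dead k := by
  intro d0
  obtain ⟨c0, d1⟩ := d0.step (by omega)
  obtain ⟨c1, d2⟩ := d1.step (by omega)
  obtain ⟨c2, d3⟩ := d2.step (by omega)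
  obtain ⟨c3, d4⟩ := d3.step (by omega)
  obtain ⟨c4, d5⟩ := d4.step (by omega)
  obtain ⟨c5, -⟩ := d5.step (by omega)
  simp only [add_assoc, Nat.reduceAdd] at c0 c1 c2 c3 c4 c5
  have s2 := G.step_y (k + 2) (by omega)
  have b2 := G.mem_y (k + 2) (by omega)
  have s4 := G.step_x (k + 4) (by omega)
  have b5 := G.mem_x (k + 5) (by omega)
  have s6 := G.step_x (k + 6) (by omega)
  have b7 := G.mem_x (k + 7) (by omega)
  have s0 := G.step_y k (by omega)
  have b0 := G.mem_y k (by omega)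
  simp only [add_assoc, Nat.reduceAdd] at s2 s4 s6
  -- The wall y = 0 forces a turn in y, which puts the label `Y` on step k + 3; one step later the
  -- wall x = m forces a turn in x.
  obtain ⟨e2, e2', l3⟩ := c2.resolve_left (by omega)
  obtain ⟨e3, e3', -⟩ := c3.resolve_right (by omega)
  rcases c4 with ⟨e4, e4', -⟩ | ⟨e4, e4', -⟩
  -- If x turns again, it is back at m and must turn once more, so y runs straight for four steps
  -- starting with a `Y`.
  · obtain ⟨e5, e5', -⟩ := c5.resolve_right (by omega)
    refine G.run_y_four (k + 3) (k + 6) (by omega) (by omega) ?_ (Or.inl l3)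
    exact (((Run.refl G.y (k + 3)).succ (by omega)).succ e4').succ e5'
  · rcases c1 with ⟨e1, e1', -⟩ | ⟨e1, e1', -⟩
    -- Steps k + 1 and k + 5 would both go from (m - 1, 2) to (m - 2, 1).
    · have := G.inj (k + 1) (by omega) (k + 5) (by omega)
        (by simp only [add_assoc, Nat.reduceAdd]; omega)
        (by simp only [add_assoc, Nat.reduceAdd]; omega)
      omega
    -- Now y is 0 at k + 1 and turns there too, so x is straight from k to k + 3, extending the run
    -- that starts at the old `X` of the dead step.
    · obtain ⟨e0, e0', -⟩ := c0.resolve_left (by omega)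
      obtain ⟨⟨a, ha, hX, hx⟩, -⟩ := d0
      exact G.run_x_four a (k + 3) (by omega) (by omega)
        (((hx.succ e0').succ e1').succ e2') (Or.inl hX)

/-- The step `i` crosses the cell in the corner `(m, 0)` or `(0, m)`, off that corner. -/
def IsCorner (G : GridPath) (i : ℕ) : Prop :=
  (G.x i = G.m - 1 ∧ G.y i = 0 ∧ G.x (i + 1) = G.m ∧ G.y (i + 1) = 1) ∨
  (G.x i = G.m ∧ G.y i = 1 ∧ G.x (i + 1) = G.m - 1 ∧ G.y (i + 1) = 0) ∨
  (G.y i = G.m - 1 ∧ G.x i = 0 ∧ G.y (i + 1) = G.m ∧ G.x (i + 1) = 1) ∨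
  (G.y i = G.m ∧ G.x i = 1 ∧ G.y (i + 1) = G.m - 1 ∧ G.x (i + 1) = 0)

lemma IsCorner.not_dead {G : GridPath} {k : ℕ} (hk : k + 6 < G.M) (h : G.IsCorner (k + 3)) :
    ¬ G.Dead k := by
  intro d
  rcases h with ⟨h1, h2, h3, h4⟩ | ⟨h1, h2, h3, h4⟩ | ⟨h1, h2, h3, h4⟩ | ⟨h1, h2, h3, h4⟩
  · exact G.not_dead_of_corner hk h1 h2 h3 h4 d
  · refine G.reflect.swap.not_dead_of_corner (k := k) hk ?_ ?_ ?_ ?_ d.reflect.swap <;>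
      simp only [GridPath.reflect, GridPath.swap, add_assoc, Nat.reduceAdd] at * <;> omega
  · exact G.swap.not_dead_of_corner hk h1 h2 h3 h4 d.swap
  · refine G.reflect.not_dead_of_corner (k := k) hk ?_ ?_ ?_ ?_ d.reflect <;>
      simp only [GridPath.reflect, add_assoc, Nat.reduceAdd] at * <;> omega

lemma IsCorner.not_live {G : GridPath} {k : ℕ} (hk : 3 ≤ k) (hk' : k + 3 < G.M)
    (h : G.IsCorner k) : ¬ G.Live (k + 3) := by
  intro d
  have d' := d.rev hk'
  refine IsCorner.not_dead (G := G.rev) (k := G.M - 1 - (k + 3))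
    (by simp only [GridPath.rev]; omega) ?_ d'
  unfold IsCorner at h ⊢
  simp only [GridPath.rev, show G.M - (G.M - 1 - (k + 3) + 3) = k + 1 by omega,
    show G.M - (G.M - 1 - (k + 3) + 3 + 1) = k by omega]
  omega

/-- The label `X` at i meets half of `Live i`, so the y-run onwards from i has no `Y`: all its
labels are `X`. It ends within four steps. Where y turns, x goes straight after an `X`, so the next
label is `Y`, and that step is dead. -/
lemma exists_dead_of_label_x {i : ℕ} (hi : i + 4 < G.M) (h : ¬ G.Live i) (hX : G.X i) :
    ∃ j, i ≤ j ∧ j ≤ i + 4 ∧ G.Dead j := by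
  have hY : ∀ b, i ≤ b → b < G.M → Run G.y i b → ¬ G.Y b := fun b h1 h2 h3 h4 =>
    h ⟨⟨i, le_rfl, by omega, hX, Run.refl _ _⟩, b, h1, h2, h4, h3⟩
  have key : ∀ n, n ≤ 4 → (∃ j, i ≤ j ∧ j ≤ i + 4 ∧ G.Dead j) ∨ Run G.y i (i + n) := by
    intro n
    induction n with
    | zero => exact fun _ => Or.inr (Run.refl _ _)
    | succ n ih =>
      intro hn
      rcases ih (by omega) with h1 | h1
      · exact Or.inl h1
      rcases G.flip_or_straight_y (i := i + n) (by omega) with h2 | h2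
      · have hX' := (G.label (i + n)).resolve_right (hY _ (by omega) (by omega) h1)
        have hs := (G.flip_or_straight_x (i := i + n) (by omega)).resolve_left
          fun h3 => G.not_both_flip (by omega) h3 h2
        have hr := (Run.refl G.x (i + n)).succ hs
        have hY' := (G.label (i + n + 1)).resolve_left
          fun h4 => G.run_x_two _ _ (by omega) (by omega) hr hX' h4
        exact Or.inl ⟨i + n + 1, by omega, by omega, ⟨i + n, by omega, hX', hr⟩,
          i + n + 1, le_rfl, hY', Run.refl _ _⟩
      · exact Or.inr (h1.succ h2)
  exact (key 4 le_rfl).resolve_right fun h1 => G.run_y_five i (i + 4) le_rfl hi h1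

lemma exists_dead_of_not_live {i : ℕ} (hi : i + 4 < G.M) (h : ¬ G.Live i) :
    ∃ j, i ≤ j ∧ j ≤ i + 4 ∧ G.Dead j := by
  rcases G.label i with hl | hl
  · exact G.exists_dead_of_label_x hi h hl
  · obtain ⟨j, h1, h2, h3⟩ := G.swap.exists_dead_of_label_x hi (fun h' => h h'.of_swap) hl
    exact ⟨j, h1, h2, h3.of_swap⟩

/-- The path is not live at k + 3, hence dead by k + 7, hence dead at l - 3, which the corner at l
forbids. -/
lemma IsCorner.not_far {G : GridPath} {k l : ℕ} (hk : G.IsCorner k) (hl : G.IsCorner l)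
    (h3 : 3 ≤ k) (hkl : k + 10 ≤ l) (hM : l + 3 < G.M) : False := by
  obtain ⟨j, -, h2, h4⟩ := G.exists_dead_of_not_live (by omega) (hk.not_live h3 (by omega))
  obtain ⟨l, rfl⟩ : ∃ l', l = l' + 3 := ⟨l - 3, by omega⟩
  exact hl.not_dead (by omega) (h4.mono (by omega) (by omega))

lemma abs_sub_le_x {i j : ℕ} (hij : i ≤ j) (hj : j ≤ G.M) : |G.x j - G.x i| ≤ j - i := by
  induction j, hij using Nat.le_induction with
  | base => simp
  | succ n hn ih =>
    have h1 := ih (by omega)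
    have h2 := G.step_x n (by omega)
    rw [abs_le] at h1 ⊢
    push_cast
    omega

lemma abs_sub_le_y {i j : ℕ} (hij : i ≤ j) (hj : j ≤ G.M) : |G.y j - G.y i| ≤ j - i :=
  G.swap.abs_sub_le_x hij hj

/-- The corner (m, 0) belongs to a single cell, and the path neither starts nor ends there; touching
it would mean entering and leaving through that same cell. -/
lemma isCorner_of_cell (hx0 : G.x 0 = 0)
    (hyM : G.y G.M = G.m) (hm : 0 < G.m) {i : ℕ} (hi : i < G.M)
    (hx : G.x i + G.x (i + 1) = 2 * G.m - 1) (hy : G.y i + G.y (i + 1) = 1) : G.IsCorner i := by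
  have s1 := G.step_x i hi
  have s2 := G.step_y i hi
  have n1 : ¬ (G.x i = G.m ∧ G.y i = 0) := by
    rintro ⟨h1, h1'⟩
    obtain ⟨j, rfl⟩ : ∃ j, i = j + 1 := Nat.exists_eq_succ_of_ne_zero (by rintro rfl; omega)
    have t1 := G.step_x j (by omega)
    have t2 := G.step_y j (by omega)
    have b1 := (G.mem_x j (by omega)).2
    have b2 := (G.mem_y j (by omega)).1
    have := G.inj j (by omega) (j + 1) hi (by omega) (by omega)
    omega
  have n2 : ¬ (G.x (i + 1) = G.m ∧ G.y (i + 1) = 0) := by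
    rintro ⟨h2, h2'⟩
    have hi' : i + 1 < G.M := by
      by_contra hc
      rw [show i + 1 = G.M by omega] at h2'
      omega
    have t1 := G.step_x (i + 1) hi'
    have t2 := G.step_y (i + 1) hi'
    have b1 := (G.mem_x (i + 1 + 1) (by omega)).2
    have b2 := (G.mem_y (i + 1 + 1) (by omega)).1
    have := G.inj i (by omega) (i + 1) hi' (by omega) (by omega)
    omega
  have c : G.x i = G.m - 1 ∧ G.y i = 0 ∨ G.x i = G.m ∧ G.y i = 1 := by omega
  rcases c with ⟨c1, c2⟩ | ⟨c1, c2⟩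
  · exact Or.inl ⟨c1, c2, by omega, by omega⟩
  · exact Or.inr (Or.inl ⟨c1, c2, by omega, by omega⟩)

/-- A labelled grid path cannot go from corner to opposite corner through all cells of a large
square. -/
theorem not_covering (hx0 : G.x 0 = 0) (hy0 : G.y 0 = 0) (hxM : G.x G.M = G.m)
    (hyM : G.y G.M = G.m) (hm : 20 ≤ G.m)
    (h1 : ∃ i < G.M, G.x i + G.x (i + 1) = 2 * G.m - 1 ∧ G.y i + G.y (i + 1) = 1)
    (h2 : ∃ i < G.M, G.x i + G.x (i + 1) = 1 ∧ G.y i + G.y (i + 1) = 2 * G.m - 1) : False := by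
  obtain ⟨i, hi, hix, hiy⟩ := h1
  obtain ⟨j, hj, hjx, hjy⟩ := h2
  have ci := G.isCorner_of_cell hx0 hyM (by omega) hi hix hiy
  have cj : G.IsCorner j := by
    rcases G.swap.isCorner_of_cell hy0 hxM (show 0 < G.m by omega) hj hjy hjx with
      h | h | h | h
    · exact Or.inr (Or.inr (Or.inl h))
    · exact Or.inr (Or.inr (Or.inr h))
    · exact Or.inl h
    · exact Or.inr (Or.inl h)
  -- Coordinates change by one per step, so the two corner steps are at least m - 2 apart and about
  -- m from both ends; `20 ≤ m` is generous.
  have a1 := abs_le.1 (G.abs_sub_le_x (Nat.zero_le i) hi.le)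
  have a2 := abs_le.1 (G.abs_sub_le_y hi.le le_rfl)
  have a3 := abs_le.1 (G.abs_sub_le_y (Nat.zero_le j) hj.le)
  have a4 := abs_le.1 (G.abs_sub_le_x hj.le le_rfl)
  have s1 := G.step_x i hi
  have s2 := G.step_y i hi
  have s3 := G.step_x j hj
  have s4 := G.step_y j hj
  rcases le_total i j with hij | hij
  · have a5 := abs_le.1 (G.abs_sub_le_x hij hj.le)
    exact ci.not_far cj (by omega) (by omega) (by omega)
  · have a5 := abs_le.1 (G.abs_sub_le_x hij hi.le)
    exact cj.not_far ci (by omega) (by omega) (by omega)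

end GridPath

/-! ### Similarities, area, and squares aligned with a grid. -/

open scoped Pointwise

noncomputable section

namespace PeanoCurve

open MeasureTheory Set Filter Topology

/-- The similarity of the plane with linear part `ε • L` and translation part `v`. -/
def simMap (v : Plane) (ε : ℝ) (L : Plane ≃ₗᵢ[ℝ] Plane) (q : Plane) : Plane := v + ε • L q

lemma simMap_image (v : Plane) (ε : ℝ) (L : Plane ≃ₗᵢ[ℝ] Plane) (S : Set Plane) :
    simMap v ε L '' S = v +ᵥ (ε • (L '' S)) := by
  ext w
  simp [simMap, Set.mem_vadd_set, Set.mem_smul_set]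

lemma continuous_simMap (v : Plane) (ε : ℝ) (L : Plane ≃ₗᵢ[ℝ] Plane) :
    Continuous (simMap v ε L) := by
  unfold simMap
  fun_prop

lemma isOpenMap_simMap (v : Plane) {ε : ℝ} (hε : ε ≠ 0) (L : Plane ≃ₗᵢ[ℝ] Plane) :
    IsOpenMap (simMap v ε L) :=
  ((L.toHomeomorph.trans (Homeomorph.smulOfNeZero ε hε)).trans (Homeomorph.addLeft v)).isOpenMap

lemma volume_simMap_image (v : Plane) (ε : ℝ) (L : Plane ≃ₗᵢ[ℝ] Plane)
    (S : Set Plane) : volume (simMap v ε L '' S) = ENNReal.ofReal (ε ^ 2) * volume S := by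
  rw [simMap_image, measure_vadd, Measure.addHaar_smul, finrank_euclideanSpace_fin,
    abs_of_nonneg (by positivity)]
  congr 1
  have := L.measurePreserving.measure_preimage_equiv (f := L.toMeasurableEquiv) (L '' S)
  rw [← this]
  congr 1
  exact Set.preimage_image_eq S L.injective

lemma isCompact_coordSquare (s : ℝ) : IsCompact (coordSquare s) := by
  have h : coordSquare s = (EuclideanSpace.equiv (Fin 2) ℝ).toHomeomorph ⁻¹'
      (Set.pi univ fun _ => Icc 0 s) := by
    ext q
    simp only [coordSquare, mem_ofPred_eq, mem_preimage, mem_univ_pi]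
    rfl
  rw [h]
  exact (Homeomorph.isCompact_preimage _).2 (isCompact_univ_pi fun _ => isCompact_Icc)

lemma isOpen_openSquare : IsOpen {q : Plane | ∀ i, q i ∈ Ioo (0 : ℝ) 1} := by
  simp only [ofPred_forall]
  refine isOpen_iInter_of_finite fun i => ?_
  exact isOpen_Ioo.preimage (f := fun q : Plane => q i) (by fun_prop)

lemma volume_coordSquare_ne_top : volume (coordSquare 1) ≠ ∞ :=
  (isCompact_coordSquare 1).measure_lt_top.ne

lemma volume_coordSquare_ne_zero : volume (coordSquare 1) ≠ 0 := by
  have h : 0 < volume {q : Plane | ∀ i, q i ∈ Ioo (0 : ℝ) 1} :=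
    isOpen_openSquare.measure_pos _ ⟨!₂[1/2, 1/2], fun i => by fin_cases i <;> norm_num⟩
  exact (h.trans_le (measure_mono fun q hq i => Ioo_subset_Icc_self (hq i))).ne'

/-- Any overlap of positive measure would be counted twice in the sum, making it exceed the measure
of the union; finiteness permits the cancellation. -/
lemma measure_inter_eq_zero_of_sum_le {α ι : Type*} [MeasurableSpace α] [DecidableEq ι]
    (μ : Measure α) (s : Finset ι) (T : ι → Set α) (hT : ∀ k ∈ s, MeasurableSet (T k))
    (hfin : ∑ k ∈ s, μ (T k) ≠ ∞) (h : ∑ k ∈ s, μ (T k) ≤ μ (⋃ k ∈ s, T k)) {k l : ι}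
    (hk : k ∈ s) (hl : l ∈ s) (hkl : k ≠ l) : μ (T k ∩ T l) = 0 := by
  have hl' : l ∈ s.erase k := Finset.mem_erase.2 ⟨hkl.symm, hl⟩
  have e : ∑ i ∈ s, μ (T i) = μ (T k) + (μ (T l) + ∑ i ∈ (s.erase k).erase l, μ (T i)) := by
    rw [Finset.add_sum_erase _ (fun i => μ (T i)) hl', Finset.add_sum_erase _ (fun i => μ (T i)) hk]
  have u : (⋃ i ∈ s, T i) ⊆ (T k ∪ T l) ∪ ⋃ i ∈ (s.erase k).erase l, T i := by
    intro x hx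
    simp only [mem_iUnion, mem_union, Finset.mem_erase] at hx ⊢
    obtain ⟨i, hi, hxi⟩ := hx
    by_cases h1 : i = k
    · exact Or.inl (Or.inl (h1 ▸ hxi))
    by_cases h2 : i = l
    · exact Or.inl (Or.inr (h2 ▸ hxi))
    exact Or.inr ⟨i, ⟨h2, h1, hi⟩, hxi⟩
  have h2 : μ (⋃ i ∈ s, T i) ≤ μ (T k ∪ T l) + ∑ i ∈ (s.erase k).erase l, μ (T i) :=
    (measure_mono u).trans ((measure_union_le _ _).trans
      (add_le_add le_rfl (measure_biUnion_finset_le _ _)))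
  have h3 := measure_union_add_inter (μ := μ) (T k) (hT l hl)
  have h4 := h.trans h2
  rw [e, ← add_assoc, ← h3] at h4
  rw [e, ← add_assoc, ← h3] at hfin
  have f1 : μ (T k ∪ T l) ≠ ∞ := fun h => hfin (by simp [h])
  have f2 : ∑ i ∈ (s.erase k).erase l, μ (T i) ≠ ∞ := fun h => hfin (by simp [h])
  have h5 := ENNReal.le_of_add_le_add_right f2 h4
  by_contra h6
  exact absurd h5 (not_le.2 (ENNReal.lt_add_right f1 h6))

/-- An affine map takes the unit square to the grid cell `(i, j)` of size `ε`, up to a symmetry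
of the square. -/
def Aligned (A : Plane → Plane) (ε : ℝ) (i j : ℕ) : Prop :=
  ∃ f g : ℝ → ℝ, (f = (fun s => s) ∨ f = fun s => 1 - s) ∧ (g = (fun s => s) ∨ g = fun s => 1 - s) ∧
    ((∀ q, A q 0 = ε * (i + f (q 0)) ∧ A q 1 = ε * (j + g (q 1))) ∨
      ∀ q, A q 0 = ε * (i + f (q 1)) ∧ A q 1 = ε * (j + g (q 0)))

lemma flip_mem {f : ℝ → ℝ} (hf : f = (fun s => s) ∨ f = fun s => 1 - s) {s : ℝ}
    (hs : s ∈ Icc (0 : ℝ) 1) : f s ∈ Icc (0 : ℝ) 1 := by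
  rcases hf with rfl | rfl
  · exact hs
  · exact ⟨by linarith [hs.2], by linarith [hs.1]⟩

lemma flip_flip {f : ℝ → ℝ} (hf : f = (fun s => s) ∨ f = fun s => 1 - s) (s : ℝ) :
    f (f s) = s := by
  rcases hf with rfl | rfl <;> simp

lemma Aligned.mem {A : Plane → Plane} {ε : ℝ} {i j : ℕ} (h : Aligned A ε i j) (hε : 0 ≤ ε)
    {q : Plane} (hq : q ∈ coordSquare 1) :
    A q 0 ∈ Icc (i * ε) ((i + 1) * ε) ∧ A q 1 ∈ Icc (j * ε) ((j + 1) * ε) := by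
  obtain ⟨f, g, hf, hg, h | h⟩ := h
  · obtain ⟨h1, h2⟩ := h q
    have b1 := flip_mem hf (hq 0)
    have b2 := flip_mem hg (hq 1)
    rw [h1, h2]
    exact ⟨⟨by nlinarith [b1.1], by nlinarith [b1.2]⟩, by nlinarith [b2.1], by nlinarith [b2.2]⟩
  · obtain ⟨h1, h2⟩ := h q
    have b1 := flip_mem hf (hq 1)
    have b2 := flip_mem hg (hq 0)
    rw [h1, h2]
    exact ⟨⟨by nlinarith [b1.1], by nlinarith [b1.2]⟩, by nlinarith [b2.1], by nlinarith [b2.2]⟩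

lemma Aligned.exists_eq {A : Plane → Plane} {ε : ℝ} {i j : ℕ} (h : Aligned A ε i j) (hε : 0 < ε)
    {w : Plane} (h0 : w 0 ∈ Icc (i * ε) ((i + 1) * ε)) (h1 : w 1 ∈ Icc (j * ε) ((j + 1) * ε)) :
    ∃ q ∈ coordSquare 1, A q = w := by
  have c0 : w 0 / ε - i ∈ Icc (0 : ℝ) 1 := by
    rw [mem_Icc, sub_nonneg, le_div_iff₀ hε, sub_le_iff_le_add, div_le_iff₀ hε]
    exact ⟨h0.1, by linarith [h0.2]⟩
  have c1 : w 1 / ε - j ∈ Icc (0 : ℝ) 1 := by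
    rw [mem_Icc, sub_nonneg, le_div_iff₀ hε, sub_le_iff_le_add, div_le_iff₀ hε]
    exact ⟨h1.1, by linarith [h1.2]⟩
  obtain ⟨f, g, hf, hg, h | h⟩ := h
  · refine ⟨!₂[f (w 0 / ε - i), g (w 1 / ε - j)], fun r => ?_, ?_⟩
    · fin_cases r
      · exact flip_mem hf c0
      · exact flip_mem hg c1
    · ext r
      fin_cases r
      · refine (h _).1.trans ?_
        change ε * (i + f (f _)) = w 0
        rw [flip_flip hf]; field_simp; ring
      · refine (h _).2.trans ?_
        change ε * (j + g (g _)) = w 1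
        rw [flip_flip hg]; field_simp; ring
  · refine ⟨!₂[g (w 1 / ε - j), f (w 0 / ε - i)], fun r => ?_, ?_⟩
    · fin_cases r
      · exact flip_mem hg c1
      · exact flip_mem hf c0
    · ext r
      fin_cases r
      · refine (h _).1.trans ?_
        change ε * (i + f (f _)) = w 0
        rw [flip_flip hf]; field_simp; ring
      · refine (h _).2.trans ?_
        change ε * (j + g (g _)) = w 1
        rw [flip_flip hg]; field_simp; ring

/-- If a unit square with side directions `a`, `b` lies, near its point `(c, d)`, in the quadrant with
apex there, then `c` is an end of the side along `a`. -/
lemma eq_zero_or_one_of_quadrant {a0 a1 b0 b1 c d : ℝ} (ha : a0 ^ 2 + a1 ^ 2 = 1)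
    (hc : c ∈ Icc (0 : ℝ) 1) (hd : d ∈ Icc (0 : ℝ) 1)
    (H : ∀ q ∈ Icc (0 : ℝ) 1, ∀ r ∈ Icc (0 : ℝ) 1, (q - c) * a1 + (r - d) * b1 < 1 →
      0 ≤ (q - c) * a0 + (r - d) * b0 ∧ 0 ≤ (q - c) * a1 + (r - d) * b1) :
    (c = 0 ∧ 0 ≤ a0 ∧ 0 ≤ a1) ∨ (c = 1 ∧ a0 ≤ 0 ∧ a1 ≤ 0) := by
  have u1 : a1 ≤ 1 := by nlinarith
  have u2 : -1 ≤ a1 := by nlinarith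
  -- Moving only halfway towards the end of the side changes the height by at most 1/2, so the test
  -- point stays below the strip bound.
  have k1 : c < 1 → 0 ≤ a0 ∧ 0 ≤ a1 := by
    intro h
    have := H ((c + 1) / 2) ⟨by linarith [hc.1], by linarith⟩ d hd (by nlinarith [hc.1, mul_nonneg (sub_nonneg.2 hc.2) (sub_nonneg.2 u1)])
    constructor <;> by_contra! hn <;> nlinarith
  have k2 : 0 < c → a0 ≤ 0 ∧ a1 ≤ 0 := by
    intro h
    have := H (c / 2) ⟨by linarith [hc.1], by linarith [hc.2]⟩ d hd (by nlinarith [hc.2, mul_nonneg hc.1 (neg_le_iff_add_nonneg.1 u2)])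
    constructor <;> by_contra! hn <;> nlinarith
  rcases hc.1.eq_or_lt with h | h
  · exact Or.inl ⟨h.symm, k1 (by linarith)⟩
  · rcases hc.2.eq_or_lt with h' | h'
    · exact Or.inr ⟨h', k2 h⟩
    · have h1 := k1 h'
      have h2 := k2 h
      nlinarith

lemma orthonormal_nonneg {a0 a1 b0 b1 : ℝ} (h0 : 0 ≤ a0) (h1 : 0 ≤ a1) (h2 : 0 ≤ b0) (h3 : 0 ≤ b1)
    (ha : a0 ^ 2 + a1 ^ 2 = 1) (hb : b0 ^ 2 + b1 ^ 2 = 1) (hab : a0 * b0 + a1 * b1 = 0) :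
    (a0 = 1 ∧ a1 = 0 ∧ b0 = 0 ∧ b1 = 1) ∨ (a0 = 0 ∧ a1 = 1 ∧ b0 = 1 ∧ b1 = 0) := by
  have p1 : a0 * b0 = 0 := by nlinarith [mul_nonneg h0 h2, mul_nonneg h1 h3]
  have p2 : a1 * b1 = 0 := by nlinarith
  rcases mul_eq_zero.1 p1 with r | r <;> rcases mul_eq_zero.1 p2 with r' | r' <;> subst r <;>
    subst r'
  · norm_num at ha
  · exact Or.inr ⟨rfl, by nlinarith, by nlinarith, rfl⟩
  · exact Or.inl ⟨by nlinarith, rfl, rfl, by nlinarith⟩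
  · norm_num at hb

lemma simMap_apply (v : Plane) (ε : ℝ) (L : Plane ≃ₗᵢ[ℝ] Plane) (q : Plane) (r : Fin 2) :
    simMap v ε L q r = v r + ε * (q 0 * L (EuclideanSpace.single 0 1) r +
      q 1 * L (EuclideanSpace.single 1 1) r) := by
  have h : q = q 0 • EuclideanSpace.single 0 (1 : ℝ) + q 1 • EuclideanSpace.single 1 (1 : ℝ) := by
    ext r; fin_cases r <;> simp
  conv_lhs => rw [h]
  simp [simMap, mul_add]

/-- The point sent to the apex is a vertex of the square. The two sides, directed away from it, are
orthonormal vectors in the closed first quadrant, hence the coordinate axes. Only heights below (j +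
1)ε are constrained because, when rows are filled upwards, nothing is known about higher rows. -/
lemma aligned_of_quadrant {v : Plane} {ε : ℝ} (hε : 0 < ε) {L : Plane ≃ₗᵢ[ℝ] Plane} {i j : ℕ}
    {c : Plane} (hc : c ∈ coordSquare 1) (hc0 : simMap v ε L c 0 = i * ε)
    (hc1 : simMap v ε L c 1 = j * ε)
    (H : ∀ q ∈ coordSquare 1, simMap v ε L q 1 < (j + 1) * ε →
      i * ε ≤ simMap v ε L q 0 ∧ j * ε ≤ simMap v ε L q 1) :
    Aligned (simMap v ε L) ε i j := by
  have n0 : ‖L (EuclideanSpace.single 0 1)‖ = 1 := by simp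
  have n1 : ‖L (EuclideanSpace.single 1 1)‖ = 1 := by simp
  have n2 : inner ℝ (L (EuclideanSpace.single 0 1)) (L (EuclideanSpace.single 1 1)) = 0 := by
    rw [L.inner_map_map, EuclideanSpace.inner_single_left]; simp
  simp only [simMap_apply] at *
  simp only [Aligned, simMap_apply]
  rw [EuclideanSpace.norm_eq, Real.sqrt_eq_one] at n0 n1
  rw [PiLp.inner_apply] at n2
  simp only [Fin.sum_univ_two, Real.norm_eq_abs, sq_abs, RCLike.inner_apply, conj_trivial]
    at n0 n1 n2
  set a0 := L (EuclideanSpace.single 0 1) 0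
  set a1 := L (EuclideanSpace.single 0 1) 1
  set b0 := L (EuclideanSpace.single 1 1) 0
  set b1 := L (EuclideanSpace.single 1 1) 1
  have H' : ∀ q ∈ Icc (0 : ℝ) 1, ∀ r ∈ Icc (0 : ℝ) 1, (q - c 0) * a1 + (r - c 1) * b1 < 1 →
      0 ≤ (q - c 0) * a0 + (r - c 1) * b0 ∧ 0 ≤ (q - c 0) * a1 + (r - c 1) * b1 := by
    intro q hq r hr h
    have := H !₂[q, r] (fun s => by fin_cases s <;> assumption)
      (by simp only [Matrix.cons_val_zero, Matrix.cons_val_one]; nlinarith)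
    simp only [Matrix.cons_val_zero, Matrix.cons_val_one] at this
    constructor
    · have h3 : 0 ≤ ε * ((q - c 0) * a0 + (r - c 1) * b0) := by linarith
      exact nonneg_of_mul_nonneg_right h3 hε
    · have h3 : 0 ≤ ε * ((q - c 0) * a1 + (r - c 1) * b1) := by linarith
      exact nonneg_of_mul_nonneg_right h3 hε
  have A1 := eq_zero_or_one_of_quadrant n0 (hc 0) (hc 1) H'
  have A2 := eq_zero_or_one_of_quadrant (b0 := a0) (b1 := a1) n1 (hc 1) (hc 0)
    fun q hq r hr h => by
      have := H' r hr q hq (by linarith)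
      constructor <;> linarith
  rcases A1 with ⟨e, s0, s1⟩ | ⟨e, s0, s1⟩ <;> rcases A2 with ⟨e', t0, t1⟩ | ⟨e', t0, t1⟩ <;>
    rw [e, e'] at hc0 hc1
  · rcases orthonormal_nonneg s0 s1 t0 t1 n0 n1 (by linarith) with ⟨r0, r1, r2, r3⟩ | ⟨r0, r1, r2, r3⟩
      <;> simp only [r0, r1, r2, r3] at hc0 hc1 ⊢ <;>
      refine ⟨fun s => s, fun s => s, Or.inl rfl, Or.inl rfl, ?_⟩
    · exact Or.inl fun q => ⟨by linarith, by linarith⟩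
    · exact Or.inr fun q => ⟨by linarith, by linarith⟩
  · rcases orthonormal_nonneg s0 s1 (neg_nonneg.2 t0) (neg_nonneg.2 t1) n0 (by linarith)
      (by linarith) with ⟨r0, r1, r2, r3⟩ | ⟨r0, r1, r2, r3⟩ <;>
      rw [neg_eq_iff_eq_neg] at r2 r3 <;> simp only [r0, r1, r2, r3] at hc0 hc1 ⊢
    · exact ⟨fun s => s, fun s => 1 - s, Or.inl rfl, Or.inr rfl,
        Or.inl fun q => ⟨by linarith, by linarith⟩⟩
    · exact ⟨fun s => 1 - s, fun s => s, Or.inr rfl, Or.inl rfl,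
        Or.inr fun q => ⟨by linarith, by linarith⟩⟩
  · rcases orthonormal_nonneg (neg_nonneg.2 s0) (neg_nonneg.2 s1) t0 t1 (by linarith) n1
      (by linarith) with ⟨r0, r1, r2, r3⟩ | ⟨r0, r1, r2, r3⟩ <;>
      rw [neg_eq_iff_eq_neg] at r0 r1 <;> simp only [r0, r1, r2, r3] at hc0 hc1 ⊢
    · exact ⟨fun s => 1 - s, fun s => s, Or.inr rfl, Or.inl rfl,
        Or.inl fun q => ⟨by linarith, by linarith⟩⟩
    · exact ⟨fun s => s, fun s => 1 - s, Or.inl rfl, Or.inr rfl,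
        Or.inr fun q => ⟨by linarith, by linarith⟩⟩
  · rcases orthonormal_nonneg (neg_nonneg.2 s0) (neg_nonneg.2 s1) (neg_nonneg.2 t0)
      (neg_nonneg.2 t1) (by linarith) (by linarith)
      (by linarith) with ⟨r0, r1, r2, r3⟩ | ⟨r0, r1, r2, r3⟩ <;>
      rw [neg_eq_iff_eq_neg] at r0 r1 r2 r3 <;> simp only [r0, r1, r2, r3] at hc0 hc1 ⊢ <;>
      refine ⟨fun s => 1 - s, fun s => 1 - s, Or.inr rfl, Or.inr rfl, ?_⟩
    · exact Or.inl fun q => ⟨by linarith, by linarith⟩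
    · exact Or.inr fun q => ⟨by linarith, by linarith⟩

end PeanoCurve
end

/-! ### Tilings of the square by equal squares are grids. -/

noncomputable section

namespace PeanoCurve

open MeasureTheory Set Filter Topology

/-- A finite family of similar images of the unit square that tile the unit square. -/
structure IsTiling (M : ℕ) (ε : ℝ) (A : ℕ → Plane → Plane) : Prop where
  pos : 0 < ε
  area : (M : ℝ) * ε ^ 2 = 1
  sim : ∀ k < M, ∃ v L, A k = simMap v ε L
  mem : ∀ k < M, ∀ q ∈ coordSquare 1, A k q ∈ coordSquare 1
  cover : ∀ w ∈ coordSquare 1, ∃ k < M, ∃ q ∈ coordSquare 1, A k q = w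

variable {M : ℕ} {ε : ℝ} {A : ℕ → Plane → Plane}

lemma IsTiling.continuous (h : IsTiling M ε A) {k : ℕ} (hk : k < M) : Continuous (A k) := by
  obtain ⟨v, L, e⟩ := h.sim k hk
  rw [e]
  exact continuous_simMap v ε L

lemma IsTiling.isOpenMap (h : IsTiling M ε A) {k : ℕ} (hk : k < M) : IsOpenMap (A k) := by
  obtain ⟨v, L, e⟩ := h.sim k hk
  rw [e]
  exact isOpenMap_simMap v h.pos.ne' L

lemma IsTiling.isCompact (h : IsTiling M ε A) {k : ℕ} (hk : k < M) :
    IsCompact (A k '' coordSquare 1) :=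
  (isCompact_coordSquare 1).image (h.continuous hk)

lemma IsTiling.volume_inter (h : IsTiling M ε A) {k l : ℕ} (hk : k < M) (hl : l < M)
    (hkl : k ≠ l) : volume (A k '' coordSquare 1 ∩ A l '' coordSquare 1) = 0 := by
  have hv : ∀ k ∈ Finset.range M,
      volume (A k '' coordSquare 1) = ENNReal.ofReal (ε ^ 2) * volume (coordSquare 1) := by
    intro k hk
    obtain ⟨v, L, e⟩ := h.sim k (Finset.mem_range.1 hk)
    rw [e, volume_simMap_image]
  have hs : ∑ k ∈ Finset.range M, volume (A k '' coordSquare 1) = volume (coordSquare 1) := by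
    rw [Finset.sum_congr rfl hv, Finset.sum_const, Finset.card_range, nsmul_eq_mul, ← mul_assoc,
      ← ENNReal.ofReal_natCast, ← ENNReal.ofReal_mul (by positivity), h.area, ENNReal.ofReal_one,
      one_mul]
  refine measure_inter_eq_zero_of_sum_le volume (Finset.range M) (fun k => A k '' coordSquare 1)
    (fun k hk => (h.isCompact (Finset.mem_range.1 hk)).measurableSet) ?_ ?_
    (Finset.mem_range.2 hk) (Finset.mem_range.2 hl) hkl
  · rw [hs]; exact volume_coordSquare_ne_top
  · rw [hs]
    refine measure_mono fun w hw => ?_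
    obtain ⟨k, hk, q, hq, e⟩ := h.cover w hw
    exact mem_biUnion (Finset.mem_coe.2 (Finset.mem_range.2 hk)) ⟨q, hq, e⟩

/-- A tile in the first open quadrant near a point `z` of the square. -/
lemma IsTiling.exists_tile (h : IsTiling M ε A) {z : Plane} (h0 : 0 ≤ z 0) (h1 : z 0 < 1)
    (h2 : 0 ≤ z 1) (h3 : z 1 < 1) : ∃ k < M, (∃ c ∈ coordSquare 1, A k c = z) ∧
      ∃ w ∈ A k '' coordSquare 1, z 0 < w 0 ∧ z 1 < w 1 := by
  let w : ℝ → Plane := fun d => z + d • !₂[1, 1]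
  have w0 : ∀ d, w d 0 = z 0 + d := fun d => by simp [w]
  have w1 : ∀ d, w d 1 = z 1 + d := fun d => by simp [w]
  have hw : ∃ᶠ d in 𝓝[>] (0 : ℝ), ∃ k ∈ Finset.range M, w d ∈ A k '' coordSquare 1 := by
    apply Eventually.frequently
    have hd : (0 : ℝ) < min (1 - z 0) (1 - z 1) := lt_min (by linarith) (by linarith)
    filter_upwards [Ioo_mem_nhdsGT hd] with d hd
    have d1 := lt_min_iff.1 hd.2
    obtain ⟨k, hk, q, hq, e⟩ := h.cover (w d) (fun r => by
      fin_cases r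
      · exact ⟨by simp only [Fin.zero_eta, w0]; linarith [hd.1],
          by simp only [Fin.zero_eta, w0]; linarith [d1.1]⟩
      · exact ⟨by simp only [Fin.mk_one, w1]; linarith [hd.1],
          by simp only [Fin.mk_one, w1]; linarith [d1.2]⟩)
    exact ⟨k, Finset.mem_range.2 hk, q, hq, e⟩
  -- There are finitely many tiles, so one contains points w d with d arbitrarily small; being
  -- closed, it contains z.
  have hw' : ∃ k ∈ Finset.range M, ∃ᶠ d in 𝓝[>] (0 : ℝ), w d ∈ A k '' coordSquare 1 := by
    by_contra! hc
    refine hw ?_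
    have := (Finset.eventually_all (Finset.range M)).2 fun k hk => hc k hk
    filter_upwards [this] with d hd
    push Not
    exact hd
  obtain ⟨k, hk, hf⟩ := hw'
  refine ⟨k, Finset.mem_range.1 hk, ?_, ?_⟩
  · have hcl := (h.isCompact (Finset.mem_range.1 hk)).isClosed
    have ht : Tendsto w (𝓝[>] 0) (𝓝 z) := by
      have : Continuous w := by fun_prop
      have h' := (this.tendsto 0).mono_left (nhdsWithin_le_nhds (s := Ioi 0))
      simpa [w] using h'
    exact hcl.mem_of_frequently_of_tendsto hf ht
  · obtain ⟨d, hd, hd'⟩ := (hf.and_eventually self_mem_nhdsWithin).exists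
    exact ⟨w d, hd, by rw [w0]; linarith [show 0 < d from hd'], by rw [w1]; linarith [show 0 < d from hd']⟩

/-- The index of a grid cell that contains a coordinate. -/
lemma ceil_sub_one_mem {ε s : ℝ} (hε : 0 < ε) (hs : 0 ≤ s) :
    s ∈ Icc (((⌈s / ε⌉₊ - 1 : ℕ) : ℝ) * ε) (((⌈s / ε⌉₊ - 1 : ℕ) + 1) * ε) := by
  -- Rounding up and subtracting one assigns a common edge to the lower cell, in particular s = 1 to
  -- a cell starting below 1; truncated subtraction sends s = 0 to cell 0.
  have h1 : s / ε ≤ (⌈s / ε⌉₊ - 1 : ℕ) + 1 := by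
    have := Nat.le_ceil (s / ε)
    have h2 : (⌈s / ε⌉₊ : ℝ) ≤ (⌈s / ε⌉₊ - 1 : ℕ) + 1 := by exact_mod_cast (by omega)
    linarith
  have h2 : ((⌈s / ε⌉₊ - 1 : ℕ) : ℝ) ≤ s / ε := by
    rcases Nat.eq_zero_or_pos (⌈s / ε⌉₊ - 1) with h | h
    · rw [h]; simp; positivity
    · exact (Nat.lt_ceil.1 (by omega)).le
  exact ⟨(le_div_iff₀ hε).1 h2, (div_le_iff₀ hε).1 h1⟩

lemma ceil_sub_one_mul_lt {ε s : ℝ} (hε : 0 < ε) (hs : s ≤ 1) :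
    ((⌈s / ε⌉₊ - 1 : ℕ) : ℝ) * ε < 1 := by
  rcases Nat.eq_zero_or_pos (⌈s / ε⌉₊ - 1) with h | h
  · rw [h]; simp
  · have := Nat.lt_ceil.1 (show ⌈s / ε⌉₊ - 1 < ⌈s / ε⌉₊ by omega)
    rw [lt_div_iff₀ hε] at this
    linarith

lemma ceil_sub_one_lt {ε s : ℝ} (hε : 0 < ε) (hs : 0 ≤ s) {i : ℕ} (h : s < i * ε) :
    ⌈s / ε⌉₊ - 1 < i := by
  have h1 : ⌈s / ε⌉₊ ≤ i := Nat.ceil_le.2 ((div_le_iff₀ hε).2 h.le)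
  have h2 : 0 < i := by
    rcases Nat.eq_zero_or_pos i with rfl | h2
    · simp at h; linarith
    · exact h2
  omega

/-- The inductive step in filling the grid row by row. -/
lemma IsTiling.exists_aligned_step (h : IsTiling M ε A) {i j : ℕ} (hi : i * ε < 1) (hj : j * ε < 1)
    (ih : ∀ i' j' : ℕ, i' * ε < 1 → j' * ε < 1 → (j' < j ∨ j' = j ∧ i' < i) →
      ∃ k < M, Aligned (A k) ε i' j') : ∃ k < M, Aligned (A k) ε i j := by
  have hε := h.pos
  obtain ⟨k, hk, ⟨c, hc, hcz⟩, w, hw, hw0, hw1⟩ := h.exists_tile (z := !₂[i * ε, j * ε])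
    (by simp; positivity) hi (by simp; positivity) hj
  change i * ε < w 0 at hw0
  change j * ε < w 1 at hw1
  refine ⟨k, hk, ?_⟩
  have hc0 : A k c 0 = i * ε := by rw [hcz]; rfl
  have hc1 : A k c 1 = j * ε := by rw [hcz]; rfl
  set O : Set Plane := {q : Plane | ∀ r, q r ∈ Ioo (0 : ℝ) 1} with hO
  have hOQ : ∀ q ∈ O, q ∈ coordSquare 1 := fun q hq r => Ioo_subset_Icc_self (hq r)
  -- `U` is the part of the open square that the tile sends into cells already filled. Its image
  -- overlaps other tiles, so it is null; it is also open, so `U` is empty.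
  set U : Set Plane := {q | q ∈ O ∧ A k q 1 < (j + 1) * ε ∧ (A k q 0 < i * ε ∨ A k q 1 < j * ε)}
    with hU
  have hUo : IsOpen U := by
    have cA := h.continuous hk
    have c0 : Continuous fun q => A k q 0 := by fun_prop
    have c1 : Continuous fun q => A k q 1 := by fun_prop
    exact isOpen_openSquare.inter ((isOpen_lt c1 continuous_const).inter
      ((isOpen_lt c0 continuous_const).union (isOpen_lt c1 continuous_const)))
  have hsub : A k '' U ⊆ ⋃ l ∈ (Finset.range M).erase k,
      (A k '' coordSquare 1 ∩ A l '' coordSquare 1) := by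
    rintro _ ⟨q, ⟨hqO, hq1, hq2⟩, rfl⟩
    have hqs := h.mem k hk q (hOQ q hqO)
    set a := ⌈A k q 0 / ε⌉₊ - 1
    set b := ⌈A k q 1 / ε⌉₊ - 1
    have hlex : b < j ∨ b = j ∧ a < i := by
      rcases lt_or_ge (A k q 1) (j * ε) with h1 | h1
      · exact Or.inl (ceil_sub_one_lt hε (hqs 1).1 h1)
      · have h2 := ceil_sub_one_lt hε (hqs 1).1 (i := j + 1) (by push_cast; exact hq1)
        have h3 := ceil_sub_one_lt hε (hqs 0).1 (hq2.resolve_right (not_lt.2 h1))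
        omega
    obtain ⟨l, hl, hal⟩ := ih a b (ceil_sub_one_mul_lt hε (hqs 0).2)
      (ceil_sub_one_mul_lt hε (hqs 1).2) hlex
    obtain ⟨q', hq', e⟩ := hal.exists_eq hε (ceil_sub_one_mem hε (hqs 0).1)
      (ceil_sub_one_mem hε (hqs 1).1)
    -- The tile k has a point strictly above and to the right of (iε, jε), which no earlier cell
    -- contains.
    have hlk : l ≠ k := by
      rintro rfl
      obtain ⟨q'', hq'', rfl⟩ := hw
      obtain ⟨m0, m1⟩ := hal.mem hε.le hq''
      rcases hlex with hb | ⟨-, ha⟩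
      · have : (b : ℝ) + 1 ≤ j := by exact_mod_cast hb
        nlinarith [m1.2]
      · have : (a : ℝ) + 1 ≤ i := by exact_mod_cast ha
        nlinarith [m0.2]
    exact mem_biUnion (Finset.mem_coe.2 (Finset.mem_erase.2 ⟨hlk, Finset.mem_range.2 hl⟩))
      ⟨⟨q, hOQ q hqO, rfl⟩, q', hq', e⟩
  have hU0 : ∀ q, q ∉ U := by
    have hnull : volume (A k '' U) = 0 := by
      refine measure_mono_null hsub ((measure_biUnion_null_iff (Finset.countable_toSet _)).2 ?_)
      intro l hl
      rw [Finset.coe_erase, Set.mem_sdiff, Finset.mem_coe, Finset.mem_range] at hl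
      exact h.volume_inter hk hl.1 fun e => hl.2 e.symm
    have := (h.isOpenMap hk U hUo).measure_eq_zero_iff volume |>.1 hnull
    rw [image_eq_empty] at this
    exact fun q => this ▸ notMem_empty q
  obtain ⟨v, L, e⟩ := h.sim k hk
  have cA := h.continuous hk
  rw [e] at hc0 hc1 cA hU ⊢
  refine aligned_of_quadrant hε hc hc0 hc1 fun q hq hq1 => ?_
  -- Boundary points of the square are reached as limits of interior points, along the segment to
  -- the centre.
  let p : ℝ → Plane := fun s => q + s • (!₂[1/2, 1/2] - q)
  have hp : ∀ᶠ s in 𝓝[>] (0 : ℝ), p s ∈ O := by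
    filter_upwards [Ioo_mem_nhdsGT (zero_lt_one' ℝ)] with s hs r
    have e1 : p s r = q r + s * (1 / 2 - q r) := by fin_cases r <;> simp [p]
    rw [e1]
    constructor
    · nlinarith [(hq r).1, (hq r).2, hs.1, hs.2, mul_nonneg (hq r).1 (sub_nonneg.2 hs.2.le)]
    · nlinarith [(hq r).1, (hq r).2, hs.1, hs.2,
        mul_nonneg (sub_nonneg.2 (hq r).2) (sub_nonneg.2 hs.2.le)]
  have ht : Tendsto (fun s => simMap v ε L (p s)) (𝓝[>] 0) (𝓝 (simMap v ε L q)) := by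
    have : Continuous fun s => simMap v ε L (p s) := by fun_prop
    have h' := (this.tendsto 0).mono_left (nhdsWithin_le_nhds (s := Ioi 0))
    simpa [p] using h'
  have t0 : Tendsto (fun s => simMap v ε L (p s) 0) (𝓝[>] 0) (𝓝 (simMap v ε L q 0)) :=
    ((show Continuous fun x : Plane => x 0 by fun_prop).tendsto _).comp ht
  have t1 : Tendsto (fun s => simMap v ε L (p s) 1) (𝓝[>] 0) (𝓝 (simMap v ε L q 1)) :=
    ((show Continuous fun x : Plane => x 1 by fun_prop).tendsto _).comp ht
  have hev : ∀ᶠ s in 𝓝[>] (0 : ℝ), i * ε ≤ simMap v ε L (p s) 0 ∧ j * ε ≤ simMap v ε L (p s) 1 := by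
    filter_upwards [hp, t1.eventually (eventually_lt_nhds hq1)] with s hs hs1
    by_contra hcon
    refine hU0 (p s) ?_
    rw [hU]
    refine ⟨hs, hs1, ?_⟩
    by_contra! h'
    exact hcon h'
  exact ⟨ge_of_tendsto t0 (hev.mono fun s hs => hs.1), ge_of_tendsto t1 (hev.mono fun s hs => hs.2)⟩

lemma IsTiling.exists_aligned (h : IsTiling M ε A) (j : ℕ) :
    ∀ i : ℕ, i * ε < 1 → j * ε < 1 → ∃ k < M, Aligned (A k) ε i j := by
  induction j using Nat.strong_induction_on with
  | _ j ihj =>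
    intro i
    induction i using Nat.strong_induction_on with
    | _ i ihi =>
      intro hi hj
      refine h.exists_aligned_step hi hj fun i' j' hi' hj' hlex => ?_
      rcases hlex with hb | ⟨rfl, ha⟩
      · exact ihj j' hb i' hi' hj'
      · exact ihi i' ha hi' hj'

/-- Every symmetry of the square fixes its centre, and the image of the centre identifies the cell.
-/
lemma Aligned.unique {B : Plane → Plane} {i j i' j' : ℕ} (hε : 0 < ε) (h : Aligned B ε i j)
    (h' : Aligned B ε i' j') : i = i' ∧ j = j' := by
  have key : ∀ {a b : ℕ} {s : ℝ}, s = ε * (a + 1 / 2) → s = ε * (b + 1 / 2) → a = b := by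
    intro a b s h1 h2
    have := mul_left_cancel₀ hε.ne' (h1.symm.trans h2)
    exact_mod_cast add_right_cancel this
  have val : ∀ {a b : ℕ}, Aligned B ε a b →
      B !₂[1/2, 1/2] 0 = ε * (a + 1 / 2) ∧ B !₂[1/2, 1/2] 1 = ε * (b + 1 / 2) := by
    rintro a b ⟨f, g, hf, hg, hB | hB⟩ <;> have := hB !₂[1/2, 1/2] <;>
      rcases hf with rfl | rfl <;> rcases hg with rfl | rfl <;>
      simpa [show (1 : ℝ) - 2⁻¹ = 2⁻¹ by norm_num] using this
  exact ⟨key (val h).1 (val h').1, key (val h).2 (val h').2⟩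

/-- A tiling of a square by equal squares is a grid. -/
theorem IsTiling.grid (h : IsTiling M ε A) : ∃ (m : ℕ) (i j : ℕ → ℕ), (m : ℝ) * ε = 1 ∧ m ^ 2 = M ∧
    (∀ k < M, i k < m ∧ j k < m ∧ Aligned (A k) ε (i k) (j k)) ∧
    (∀ a < m, ∀ b < m, ∃ k < M, i k = a ∧ j k = b) ∧
    ∀ k < M, ∀ l < M, i k = i l → j k = j l → k = l := by
  have hε := h.pos
  obtain ⟨m, hm⟩ : ∃ m : ℕ, (m : ℝ) * ε = 1 := by
    -- The last cell of the bottom row is a tile, so its right edge does not pass 1.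
    refine ⟨⌈1 / ε⌉₊, le_antisymm ?_ ((div_le_iff₀ hε).1 (Nat.le_ceil _))⟩
    have hpos : 0 < ⌈1 / ε⌉₊ := Nat.ceil_pos.2 (by positivity)
    obtain ⟨k, hk, hal⟩ := h.exists_aligned 0 (⌈1 / ε⌉₊ - 1)
      (ceil_sub_one_mul_lt hε le_rfl) (by simp)
    obtain ⟨q, hq, e⟩ := hal.exists_eq hε
      (w := !₂[((⌈1 / ε⌉₊ - 1 : ℕ) + 1) * ε, 0])
      ⟨by simp only [Matrix.cons_val_zero]; nlinarith, le_rfl⟩ ⟨by simp, by simp; positivity⟩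
    have h1 := (h.mem k hk q hq 0).2
    rw [e] at h1
    have h2 : ((⌈1 / ε⌉₊ - 1 : ℕ) + 1 : ℝ) = ⌈1 / ε⌉₊ := by exact_mod_cast (by omega)
    rw [← h2]
    exact h1
  have hmM : m ^ 2 = M := by
    have h1 := h.area
    have h2 : (M : ℝ) * ε ^ 2 = (m : ℝ) ^ 2 * ε ^ 2 := by rw [h1, ← mul_pow, hm, one_pow]
    exact_mod_cast (mul_right_cancel₀ (by positivity) h2).symm
  have lt1 : ∀ a < m, (a : ℝ) * ε < 1 := fun a ha => by
    rw [← hm]; exact mul_lt_mul_of_pos_right (by exact_mod_cast ha) hε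
  choose! κ hκ hκa using fun (x : Fin m × Fin m) =>
    h.exists_aligned x.2 x.1 (lt1 _ x.1.2) (lt1 _ x.2.2)
  let κ' : Fin m × Fin m → Fin M := fun x => ⟨κ x, hκ x⟩
  have hinj : Function.Injective κ' := by
    intro x y hxy
    have e : κ x = κ y := congrArg Fin.val hxy
    have h2 := hκa y
    rw [← e] at h2
    obtain ⟨h3, h4⟩ := (hκa x).unique hε h2
    exact Prod.ext (Fin.ext h3) (Fin.ext h4)
  -- Cells and tiles are equally many, so choosing a tile for each cell exhausts the tiles.
  have hbij : Function.Bijective κ' :=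
    (Fintype.bijective_iff_injective_and_card κ').2 ⟨hinj, by simp [← hmM, sq]⟩
  let σ := Equiv.ofBijective κ' hbij
  have hσ : ∀ k (hk : k < M), κ (σ.symm ⟨k, hk⟩) = k := fun k hk =>
    congrArg Fin.val (σ.apply_symm_apply ⟨k, hk⟩)
  refine ⟨m, fun k => if hk : k < M then (σ.symm ⟨k, hk⟩).1 else 0,
    fun k => if hk : k < M then (σ.symm ⟨k, hk⟩).2 else 0, hm, hmM, ?_, ?_, ?_⟩
  · intro k hk
    simp only [hk, dif_pos]
    refine ⟨Fin.is_lt _, Fin.is_lt _, ?_⟩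
    have := hκa (σ.symm ⟨k, hk⟩)
    rwa [hσ] at this
  · intro a ha b hb
    refine ⟨κ (⟨a, ha⟩, ⟨b, hb⟩), hκ _, ?_⟩
    have : σ.symm ⟨κ (⟨a, ha⟩, ⟨b, hb⟩), hκ _⟩ = (⟨a, ha⟩, ⟨b, hb⟩) :=
      σ.symm_apply_apply (⟨a, ha⟩, ⟨b, hb⟩)
    simp only [hκ, dif_pos, this, and_self]
  · intro k hk l hl h1 h2
    simp only [hk, hl, dif_pos] at h1 h2
    have := σ.symm.injective (Prod.ext (Fin.ext h1) (Fin.ext h2))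
    exact congrArg Fin.val this

end PeanoCurve
end

/-! ### From bounds on moments to labelled paths. -/

noncomputable section

namespace GridPath

lemma Run.sub_eq {u : ℕ → ℤ} {i j : ℕ} (h : Run u i j) (hij : i ≤ j) :
    u (j + 1) - u i = (j + 1 - i) * (u (i + 1) - u i) ∧ u (j + 1) - u j = u (i + 1) - u i := by
  induction j, hij using Nat.le_induction with
  | base => constructor <;> ring
  | succ n hn ih =>
    obtain ⟨h1, h2⟩ := ih fun l a b => h l a (by omega)
    have h3 := h n hn (by omega)
    have h4 : u (n + 1 + 1) - u (n + 1) = u (i + 1) - u i := by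
      rw [show n + 1 + 1 = n + 2 from rfl]; linarith
    refine ⟨?_, h4⟩
    push_cast
    linear_combination h1 + h4

/-- A run with constant steps `±1` covers a distance equal to its length. -/
lemma Run.sq_eq {u : ℕ → ℤ} {i j : ℕ} (h : Run u i j) (hij : i ≤ j)
    (hs : u (i + 1) = u i + 1 ∨ u (i + 1) = u i - 1) :
    ((u (j + 1) - u i : ℤ) : ℝ) ^ 2 = ((j : ℝ) - i + 1) ^ 2 := by
  have h1 := (h.sub_eq hij).1
  rcases hs with hs | hs <;> rw [hs] at h1 <;> rw [h1] <;> push_cast <;> ring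

/-- The two bounds on the moments when a run leaves one side of its strip and reaches the other
side restrict the labels in the run. -/
lemma run_bounds {M : ℕ} {u : ℕ → ℤ} {w z : ℕ → ℝ}
    (step : ∀ i < M, u (i + 1) = u i + 1 ∨ u (i + 1) = u i - 1)
    (hu : ∀ i j, i < j → j < M → ((u (j + 1) - u i : ℤ) : ℝ) ^ 2 < 5 * (j - i + z j - w i))
    (hw : ∀ k < M, 1 / 5 < w k) (hz : ∀ k < M, z k < 4 / 5) {i j : ℕ} (hij : i < j) (hj : j < M)
    (h : Run u i j) :
    (3 / 5 < w i → z j < 2 / 5 → False) ∧ (i + 3 ≤ j → 3 / 5 < w i ∨ z j < 2 / 5 → False) ∧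
      (i + 4 ≤ j → False) := by
  have h1 := hu i j hij hj
  rw [h.sq_eq hij.le (step i (by omega))] at h1
  have h2 := hw i (by omega)
  have h3 := hz j hj
  obtain ⟨d, rfl⟩ : ∃ d, j = i + 1 + d := ⟨j - (i + 1), by omega⟩
  push_cast at h1
  -- With n = j - i + 1 the bound reads n² < 5(n - 1 + z j - w i). The difference z j - w i is below
  -- -1/5, 1/5 or 3/5 in the three cases, giving (n - 2)(n - 3) < 0, (n - 1)(n - 4) < 0 and n² < 5n
  -- - 2.
  refine ⟨fun h4 h5 => ?_, fun h4 h5 => ?_, fun h4 => ?_⟩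
  · rcases Nat.eq_zero_or_pos d with rfl | hd
    · norm_num at h1; linarith
    · have hd' : (1 : ℝ) ≤ d := by exact_mod_cast hd
      nlinarith
  · have hd' : (2 : ℝ) ≤ d := by exact_mod_cast (by omega : 2 ≤ d)
    rcases h5 with h5 | h5 <;> nlinarith
  · have hd' : (3 : ℝ) ≤ d := by exact_mod_cast (by omega : 3 ≤ d)
    nlinarith

/-- There is no grid path through all cells of a large square with a moment `w k` and `z k` in each
step at which the two remaining corners of the cell are visited, with small ratio. -/
theorem no_timed_path {m : ℤ} {M : ℕ} {x y : ℕ → ℤ} {w z : ℕ → ℝ}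
    (step_x : ∀ i < M, x (i + 1) = x i + 1 ∨ x (i + 1) = x i - 1)
    (step_y : ∀ i < M, y (i + 1) = y i + 1 ∨ y (i + 1) = y i - 1)
    (mem_x : ∀ i ≤ M, 0 ≤ x i ∧ x i ≤ m) (mem_y : ∀ i ≤ M, 0 ≤ y i ∧ y i ≤ m)
    (inj : ∀ i < M, ∀ j < M, x i + x (i + 1) = x j + x (j + 1) →
      y i + y (i + 1) = y j + y (j + 1) → i = j)
    (hw : ∀ k < M, 1 / 5 < w k ∧ w k < 4 / 5) (hz : ∀ k < M, 1 / 5 < z k ∧ z k < 4 / 5)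
    (hwz : ∀ k < M, 2 / 5 < |w k - z k|)
    (hx : ∀ i j, i < j → j < M → ((x (j + 1) - x i : ℤ) : ℝ) ^ 2 < 5 * (j - i + z j - w i))
    (hy : ∀ i j, i < j → j < M → ((y (j + 1) - y i : ℤ) : ℝ) ^ 2 < 5 * (j - i + w j - z i))
    (hends : x 0 = 0 ∧ y 0 = 0 ∧ x M = m ∧ y M = m ∨ x 0 = m ∧ y 0 = m ∧ x M = 0 ∧ y M = 0)
    (h1 : ∃ i < M, x i + x (i + 1) = 2 * m - 1 ∧ y i + y (i + 1) = 1)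
    (h2 : ∃ i < M, x i + x (i + 1) = 1 ∧ y i + y (i + 1) = 2 * m - 1) (hm : 20 ≤ m) : False := by
  -- A gap above 2/5 inside (1/5, 4/5) pushes the later moment past 3/5 and the earlier one below
  -- 2/5, so their order alone can serve as the label.
  have lX : ∀ k < M, z k < w k → 3 / 5 < w k ∧ z k < 2 / 5 := by
    intro k hk h
    have := hwz k hk
    rw [abs_of_pos (by linarith)] at this
    exact ⟨by linarith [(hz k hk).1], by linarith [(hw k hk).2]⟩
  have lY : ∀ k < M, ¬ z k < w k → 3 / 5 < z k ∧ w k < 2 / 5 := by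
    intro k hk h
    have := hwz k hk
    rw [abs_of_nonpos (by linarith)] at this
    exact ⟨by linarith [(hw k hk).1], by linarith [(hz k hk).2]⟩
  have bx := fun {i j : ℕ} (hij : i < j) (hj : j < M) (h : Run x i j) =>
    run_bounds step_x hx (fun k hk => (hw k hk).1) (fun k hk => (hz k hk).2) hij hj h
  have byy := fun {i j : ℕ} (hij : i < j) (hj : j < M) (h : Run y i j) =>
    run_bounds step_y hy (fun k hk => (hz k hk).1) (fun k hk => (hw k hk).2) hij hj h
  let G : GridPath :=
    { m := m, M := M, x := x, y := y, X := fun k => z k < w k, Y := fun k => ¬ z k < w k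
      label := fun k => em _
      not_both := fun k h h' => h' h
      step_x := step_x, step_y := step_y, mem_x := mem_x, mem_y := mem_y, inj := inj
      run_x_two := fun i j hij hj h hi hj' =>
        (bx hij hj h).1 (lX i (by omega) hi).1 (lX j hj hj').2
      run_x_four := fun i j hij hj h hl => (bx (by omega) hj h).2.1 hij
        (hl.imp (fun hi => (lX i (by omega) hi).1) fun hi => (lX j hj hi).2)
      run_x_five := fun i j hij hj h => (bx (by omega) hj h).2.2 hij
      run_y_two := fun i j hij hj h hi hj' =>
        (byy hij hj h).1 (lY i (by omega) hi).1 (lY j hj hj').2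
      run_y_four := fun i j hij hj h hl => (byy (by omega) hj h).2.1 hij
        (hl.imp (fun hi => (lY i (by omega) hi).1) fun hi => (lY j hj hi).2)
      run_y_five := fun i j hij hj h => (byy (by omega) hj h).2.2 hij }
  rcases hends with ⟨e1, e2, e3, e4⟩ | ⟨e1, e2, e3, e4⟩
  · exact G.not_covering e1 e2 e3 e4 hm h1 h2
  · obtain ⟨i, hi, hi1, hi2⟩ := h1
    obtain ⟨j, hj, hj1, hj2⟩ := h2
    refine G.reflect.not_covering (sub_eq_zero.2 e1.symm) (sub_eq_zero.2 e2.symm) ?_ ?_ hm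
      ⟨j, hj, ?_, ?_⟩ ⟨i, hi, ?_, ?_⟩ <;> simp only [GridPath.reflect, G] <;> omega

end GridPath

/-! ### Normalized curves and their pieces. -/

namespace PeanoCurve

open Set

/-- The map `p` on the segment `[c, c + l]` is similar to `p` on `[0, 1]`. -/
def HasPiece (p : ℝ → Plane) (c l : ℝ) : Prop :=
  ∃ σ : ℝ → ℝ, (σ = (fun s => s) ∨ σ = fun s => 1 - s) ∧ ∃ (v : Plane) (L : Plane ≃ₗᵢ[ℝ] Plane),
    ∀ s ∈ Icc (0 : ℝ) 1, p (c + l * σ s) = simMap v (Real.sqrt l) L (p s)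

/-- A map of the unit segment onto the unit square with ends on a diagonal and square-to-linear
ratios less than `5`. -/
structure IsSlowDiagonal (p : ℝ → Plane) : Prop where
  image : p '' Icc 0 1 = coordSquare 1
  start_diag : p 0 0 = p 0 1
  end_diag : p 1 0 = p 1 1
  ratio : ∀ s ∈ Icc (0 : ℝ) 1, ∀ t ∈ Icc (0 : ℝ) 1, s < t → ‖p t - p s‖ ^ 2 < 5 * (t - s)

lemma norm_sq_eq (q : Plane) : ‖q‖ ^ 2 = q 0 ^ 2 + q 1 ^ 2 := by
  rw [EuclideanSpace.norm_sq_eq, Fin.sum_univ_two, Real.norm_eq_abs, Real.norm_eq_abs, sq_abs,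
    sq_abs]

lemma IsSlowDiagonal.mem {p : ℝ → Plane} (hp : IsSlowDiagonal p) {s : ℝ} (hs : s ∈ Icc (0 : ℝ) 1) :
    p s ∈ coordSquare 1 := hp.image ▸ mem_image_of_mem p hs

lemma moment_mem {M k : ℕ} (hk : k < M) {s : ℝ} (hs : s ∈ Icc (0 : ℝ) 1) :
    (k + s) / M ∈ Icc (0 : ℝ) 1 := by
  have h1 : (k : ℝ) + 1 ≤ M := by exact_mod_cast hk
  have h2 : (0 : ℝ) < M := by exact_mod_cast (Nat.zero_le k).trans_lt hk
  rw [mem_Icc, div_le_one h2]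
  exact ⟨by have := hs.1; positivity, by linarith [hs.2]⟩

end PeanoCurve
end

noncomputable section

namespace PeanoCurve

open Set

/-- The pieces of the curve `p` on the `M` equal parts of the unit segment. -/
structure IsPieceSystem (p : ℝ → Plane) (M : ℕ) (σ : ℕ → ℝ → ℝ) (A : ℕ → Plane → Plane) : Prop where
  flip : ∀ k < M, σ k = (fun s => s) ∨ σ k = fun s => 1 - s
  apply : ∀ k < M, ∀ s ∈ Icc (0 : ℝ) 1, p ((k + s) / M) = A k (p (σ k s))

lemma exists_isPieceSystem {p : ℝ → Plane} (hp : p '' Icc 0 1 = coordSquare 1) {M : ℕ} (hM : 0 < M)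
    (h : ∀ k < M, HasPiece p (k / M) (1 / M)) :
    ∃ σ A, IsPieceSystem p M σ A ∧ IsTiling M (Real.sqrt (1 / M)) A := by
  choose! σ hσ v L hL using h
  have hM' : (0 : ℝ) < M := by exact_mod_cast hM
  have hap : ∀ k < M, ∀ s ∈ Icc (0 : ℝ) 1,
      p ((k + s) / M) = simMap (v k) (Real.sqrt (1 / M)) (L k) (p (σ k s)) := by
    intro k hk s hs
    rw [← hL k hk _ (flip_mem (hσ k hk) hs), flip_flip (hσ k hk)]
    congr 1
    ring
  refine ⟨σ, fun k => simMap (v k) (Real.sqrt (1 / M)) (L k), ⟨hσ, hap⟩, by positivity, ?_,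
    fun k hk => ⟨_, _, rfl⟩, ?_, ?_⟩
  · rw [Real.sq_sqrt (by positivity)]
    field_simp
  · intro k hk q hq
    rw [← hp] at hq ⊢
    obtain ⟨s, hs, rfl⟩ := hq
    have h1 := flip_mem (hσ k hk) hs
    refine ⟨(k + σ k s) / M, moment_mem hk h1, ?_⟩
    rw [hap k hk _ h1, flip_flip (hσ k hk)]
  · intro w hw
    rw [← hp] at hw
    obtain ⟨t, ht, rfl⟩ := hw
    have key : ∃ k < M, t * M - k ∈ Icc (0 : ℝ) 1 := by
      rcases ht.2.eq_or_lt with rfl | h1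
      -- The final moment belongs to the last piece; the floor would give the nonexistent index M.
      · refine ⟨M - 1, by omega, ?_⟩
        rw [Nat.cast_sub hM]
        norm_num
      · have h0 : 0 ≤ t * M := mul_nonneg ht.1 hM'.le
        refine ⟨⌊t * M⌋₊, (Nat.floor_lt h0).2 (by nlinarith), ?_, ?_⟩
        · linarith [Nat.floor_le h0]
        · linarith [Nat.lt_floor_add_one (t * M)]
    obtain ⟨k, hk, hs⟩ := key
    refine ⟨k, hk, p (σ k (t * M - k)), hp ▸ mem_image_of_mem p (flip_mem (hσ k hk) hs), ?_⟩
    rw [← hap k hk _ hs]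
    congr 1
    field_simp
    ring

/-- A point strictly inside a grid cell lies in no other cell. -/
lemma cell_unique {ε : ℝ} (hε : 0 < ε) {a b : ℕ} {s : ℝ} (h1 : s ∈ Ioo (a * ε) ((a + 1) * ε))
    (h2 : s ∈ Icc (b * ε) ((b + 1) * ε)) : a = b := by
  have h3 : (a : ℝ) < b + 1 := lt_of_mul_lt_mul_right (h1.1.trans_le h2.2) hε.le
  have h4 : (b : ℝ) < a + 1 := lt_of_mul_lt_mul_right (h2.1.trans_lt h1.2) hε.le
  have h5 : a < b + 1 := by exact_mod_cast h3
  have h6 : b < a + 1 := by exact_mod_cast h4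
  omega

lemma Aligned.mem_interior {B : Plane → Plane} {ε : ℝ} {i j : ℕ} (h : Aligned B ε i j) (hε : 0 < ε)
    {q : Plane} (h0 : q 0 ∈ Ioo (0 : ℝ) 1) (h1 : q 1 ∈ Ioo (0 : ℝ) 1) :
    B q 0 ∈ Ioo (i * ε) ((i + 1) * ε) ∧ B q 1 ∈ Ioo (j * ε) ((j + 1) * ε) := by
  obtain ⟨a1, a2⟩ := h0
  obtain ⟨b1, b2⟩ := h1
  obtain ⟨f, g, hf, hg, h | h⟩ := h <;> obtain ⟨h1, h2⟩ := h q <;> rw [h1, h2] <;>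
    rcases hf with rfl | rfl <;> rcases hg with rfl | rfl <;>
    exact ⟨⟨by nlinarith, by nlinarith⟩, by nlinarith, by nlinarith⟩

/-- The images of the four vertices of the unit square in an aligned tile. -/
lemma Aligned.vertices {B : Plane → Plane} {ε : ℝ} {i j : ℕ} (h : Aligned B ε i j) {c : ℝ}
    (hc : c = 0 ∨ c = 1) : ∃ a b : ℤ, (a = 0 ∨ a = 1) ∧ (b = 0 ∨ b = 1) ∧
      (∀ q, q 0 = c → q 1 = c → B q 0 = ε * (i + a) ∧ B q 1 = ε * (j + b)) ∧
      (∀ q, q 0 = 1 - c → q 1 = 1 - c → B q 0 = ε * (i + 1 - a) ∧ B q 1 = ε * (j + 1 - b)) ∧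
      ∃ d : ℝ, (d = 0 ∨ d = 1) ∧
        (∀ q, q 0 = d → q 1 = 1 - d → B q 0 = ε * (i + a) ∧ B q 1 = ε * (j + 1 - b)) ∧
        (∀ q, q 0 = 1 - d → q 1 = d → B q 0 = ε * (i + 1 - a) ∧ B q 1 = ε * (j + b)) := by
  have key : ∀ f : ℝ → ℝ, (f = (fun s => s) ∨ f = fun s => 1 - s) →
      ∃ a : ℤ, (a = 0 ∨ a = 1) ∧ f c = a ∧ f (1 - c) = 1 - a := by
    rintro f (rfl | rfl) <;> rcases hc with rfl | rfl
    · exact ⟨0, by simp⟩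
    · exact ⟨1, by simp⟩
    · exact ⟨1, by simp⟩
    · exact ⟨0, by simp⟩
  have hc' : 1 - c = 0 ∨ 1 - c = 1 := by rcases hc with rfl | rfl <;> simp
  obtain ⟨f, g, hf, hg, h | h⟩ := h <;> obtain ⟨a, ha, fa, fa'⟩ := key f hf <;>
    obtain ⟨b, hb, gb, gb'⟩ := key g hg
  · refine ⟨a, b, ha, hb, fun q h0 h1 => ?_, fun q h0 h1 => ?_, c, hc, fun q h0 h1 => ?_,
      fun q h0 h1 => ?_⟩ <;> rw [(h q).1, (h q).2, h0, h1] <;> simp only [fa, fa', gb, gb', add_sub_assoc, and_self]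
  · refine ⟨a, b, ha, hb, fun q h0 h1 => ?_, fun q h0 h1 => ?_, 1 - c, hc', fun q h0 h1 => ?_,
      fun q h0 h1 => ?_⟩ <;> rw [(h q).1, (h q).2, h0, h1] <;>
      simp only [fa, fa', gb, gb', sub_sub_cancel, add_sub_assoc, and_self]

variable {p : ℝ → Plane} {M : ℕ} {σ : ℕ → ℝ → ℝ} {A : ℕ → Plane → Plane}

/-- The endpoints of the pieces lie on the boundary of their tiles. -/
lemma IsPieceSystem.not_interior (hS : IsPieceSystem p M σ A) {ε : ℝ} (hε : 0 < ε) {i j : ℕ → ℕ}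
    (hA : ∀ k < M, Aligned (A k) ε (i k) (j k))
    (hinj : ∀ k < M, ∀ l < M, i k = i l → j k = j l → k = l) (hM : 3 ≤ M)
    (hmem : ∀ s ∈ Icc (0 : ℝ) 1, p s ∈ coordSquare 1) {e : ℝ} (he : e = 0 ∨ e = 1) :
    ¬ (p e 0 ∈ Ioo (0 : ℝ) 1 ∧ p e 1 ∈ Ioo (0 : ℝ) 1) := by
  rintro ⟨h0, h1⟩
  -- Piece 1 has neighbours on both sides, so the moment of its end corresponding to e also belongs
  -- to piece 0 or 2, whereas an interior point of a cell lies in no other cell.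
  have hf := hS.flip 1 (by omega)
  have heI : e ∈ Icc (0 : ℝ) 1 := by rcases he with rfl | rfl <;> simp
  have hσe : σ 1 e = 0 ∨ σ 1 e = 1 := by
    rcases hf with h | h <;> rcases he with rfl | rfl <;> simp [h]
  have e1 := hS.apply 1 (by omega) (σ 1 e) (flip_mem hf heI)
  rw [flip_flip hf] at e1
  obtain ⟨b0, b1⟩ := (hA 1 (by omega)).mem_interior hε h0 h1
  rw [← e1] at b0 b1
  have key : ∀ k < M, ∀ s ∈ Icc (0 : ℝ) 1, ((1 : ℕ) + σ 1 e) = (k : ℝ) + s → k = 1 := by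
    intro k hk s hs hks
    have e2 := hS.apply k hk s hs
    rw [← hks] at e2
    obtain ⟨c0, c1⟩ := (hA k hk).mem hε.le (hmem _ (flip_mem (hS.flip k hk) hs))
    rw [← e2] at c0 c1
    exact (hinj 1 (by omega) k hk (cell_unique hε b0 c0) (cell_unique hε b1 c1)).symm
  rcases hσe with h | h
  · have := key 0 (by omega) 1 (by simp) (by rw [h]; norm_num)
    omega
  · have := key 2 (by omega) 0 (by simp) (by rw [h]; norm_num)
    omega

/-- The curve goes from a corner to the opposite corner. -/
lemma IsPieceSystem.exists_corner (hS : IsPieceSystem p M σ A) {ε : ℝ} (hε : 0 < ε) {m : ℕ}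
    (hm : (m : ℝ) * ε = 1) {i j : ℕ → ℕ} (him : ∀ k < M, i k < m ∧ j k < m)
    (hA : ∀ k < M, Aligned (A k) ε (i k) (j k))
    (hinj : ∀ k < M, ∀ l < M, i k = i l → j k = j l → k = l) (hM : 3 ≤ M)
    (hp : IsSlowDiagonal p) :
    ∃ c : ℝ, (c = 0 ∨ c = 1) ∧ p 0 0 = c ∧ p 0 1 = c ∧ p 1 0 = 1 - c ∧ p 1 1 = 1 - c := by
  have hmem := fun s hs => hp.mem (s := s) hs
  have hcor : ∀ e : ℝ, (e = 0 ∨ e = 1) → p e 0 = p e 1 → p e 0 = 0 ∨ p e 0 = 1 := by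
    intro e he hd
    have heI : e ∈ Icc (0 : ℝ) 1 := by rcases he with rfl | rfl <;> simp
    have h1 := hS.not_interior hε hA hinj hM hmem he
    rw [← hd, and_self] at h1
    have h2 := hmem e heI 0
    by_contra! h3
    exact h1 ⟨lt_of_le_of_ne h2.1 h3.1.symm, lt_of_le_of_ne h2.2 h3.2⟩
  have c0 := hcor 0 (Or.inl rfl) hp.start_diag
  have c1 := hcor 1 (Or.inr rfl) hp.end_diag
  refine ⟨p 0 0, c0, rfl, hp.start_diag.symm, ?_, ?_⟩ <;> try rw [← hp.end_diag]
  all_goals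
  by_contra hne
  have heq : p 1 0 = p 0 0 := by
    rcases c0 with c0 | c0 <;> rcases c1 with c1 | c1 <;> rw [c0, c1] at hne ⊢ <;> norm_num at hne
  have hpe : p 1 = p 0 := by
    ext r
    fin_cases r
    · exact heq
    · change p 1 1 = p 0 1
      rw [← hp.end_diag, ← hp.start_diag, heq]
  -- If the ends coincide, each piece is closed and all junctions equal p 0. Then tiles 0 and 1
  -- share a corner of the whole square, which lies in one cell only.
  have hA0 : ∀ k < M, ∀ s : ℝ, (s = 0 ∨ s = 1) → p ((k + s) / M) = A k (p 0) := by
    intro k hk s hs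
    have hsI : s ∈ Icc (0 : ℝ) 1 := by rcases hs with rfl | rfl <;> simp
    rw [hS.apply k hk s hsI]
    rcases hS.flip k hk with h | h <;> rcases hs with rfl | rfl <;> simp [h, hpe]
  have z0 : A 0 (p 0) = p 0 := by
    rw [← hA0 0 (by omega) 0 (Or.inl rfl)]; simp
  have z1 : A 1 (p 0) = p 0 := by
    rw [← hA0 1 (by omega) 0 (Or.inl rfl), ← z0, ← hA0 0 (by omega) 1 (Or.inr rfl)]
    simp
  have p0 := hmem 0 (by simp)
  obtain ⟨a0, a1⟩ := (hA 0 (by omega)).mem hε.le p0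
  obtain ⟨b0, b1⟩ := (hA 1 (by omega)).mem hε.le p0
  rw [z0] at a0 a1
  rw [z1] at b0 b1
  obtain ⟨m0, m0'⟩ := him 0 (by omega)
  obtain ⟨m1, m1'⟩ := him 1 (by omega)
  have same : ∀ {a b : ℕ} {s : ℝ}, a < m → b < m → (s = 0 ∨ s = 1) →
      s ∈ Icc (a * ε) ((a + 1) * ε) → s ∈ Icc (b * ε) ((b + 1) * ε) → a = b := by
    intro a b s ha hb hs h1 h2
    rcases hs with rfl | rfl
    · have h3 : (a : ℝ) ≤ 0 := by by_contra! h; nlinarith [h1.1]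
      have h4 : (b : ℝ) ≤ 0 := by by_contra! h; nlinarith [h2.1]
      have h3' : a ≤ 0 := by exact_mod_cast h3
      have h4' : b ≤ 0 := by exact_mod_cast h4
      omega
    · have h3 : (m : ℝ) ≤ a + 1 := le_of_mul_le_mul_right (hm ▸ h1.2) hε
      have h4 : (m : ℝ) ≤ b + 1 := le_of_mul_le_mul_right (hm ▸ h2.2) hε
      have h3' : m ≤ a + 1 := by exact_mod_cast h3
      have h4' : m ≤ b + 1 := by exact_mod_cast h4
      omega
  have := hinj 0 (by omega) 1 (by omega) (same m0 m1 c0 a0 b0)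
    (same m0' m1' (hp.start_diag ▸ c0) a1 b1)
  omega

/-- In each cell the curve goes from a vertex to the opposite one, and visits the other two. -/
lemma IsPieceSystem.cell (hS : IsPieceSystem p M σ A) {ε : ℝ} {i j : ℕ → ℕ} {k : ℕ} (hk : k < M)
    (hA : Aligned (A k) ε (i k) (j k)) {c : ℝ} (hc : c = 0 ∨ c = 1) (h00 : p 0 0 = c)
    (h01 : p 0 1 = c) (h10 : p 1 0 = 1 - c) (h11 : p 1 1 = 1 - c) {t₁ t₂ : ℝ}
    (ht₁ : t₁ ∈ Icc (0 : ℝ) 1) (ht₂ : t₂ ∈ Icc (0 : ℝ) 1) (e₁ : p t₁ 0 = 1 ∧ p t₁ 1 = 0)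
    (e₂ : p t₂ 0 = 0 ∧ p t₂ 1 = 1) :
    ∃ (a b : ℤ) (w z : ℝ), (a = 0 ∨ a = 1) ∧ (b = 0 ∨ b = 1) ∧
      (p ((k + 0) / M) 0 = ε * (i k + a) ∧ p ((k + 0) / M) 1 = ε * (j k + b)) ∧
      (p ((k + 1) / M) 0 = ε * (i k + 1 - a) ∧ p ((k + 1) / M) 1 = ε * (j k + 1 - b)) ∧
      (w = σ k t₁ ∧ z = σ k t₂ ∨ w = σ k t₂ ∧ z = σ k t₁) ∧
      (p ((k + w) / M) 0 = ε * (i k + a) ∧ p ((k + w) / M) 1 = ε * (j k + 1 - b)) ∧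
      (p ((k + z) / M) 0 = ε * (i k + 1 - a) ∧ p ((k + z) / M) 1 = ε * (j k + b)) := by
  have hf := hS.flip k hk
  have hap := hS.apply k hk
  have q1 : p ((k + σ k t₁) / M) = A k (p t₁) := by rw [hap _ (flip_mem hf ht₁), flip_flip hf]
  have q2 : p ((k + σ k t₂) / M) = A k (p t₂) := by rw [hap _ (flip_mem hf ht₂), flip_flip hf]
  obtain ⟨c', hc', s0, s0', s1, s1'⟩ : ∃ c' : ℝ, (c' = 0 ∨ c' = 1) ∧ p (σ k 0) 0 = c' ∧
      p (σ k 0) 1 = c' ∧ p (σ k 1) 0 = 1 - c' ∧ p (σ k 1) 1 = 1 - c' := by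
    rcases hf with h | h
    · exact ⟨c, hc, by simp [*]⟩
    · exact ⟨1 - c, by rcases hc with rfl | rfl <;> simp, by simp [*]⟩
  -- The moment w is at the vertex with the abscissa of the start and the ordinate of the end, z at
  -- the other; d tells which of (1, 0), (0, 1) the tile sends to the vertex of w.
  obtain ⟨a, b, ha, hb, v0, v1, d, hd, v2, v3⟩ := hA.vertices hc'
  rw [hap 0 (by simp), hap 1 (by simp)]
  rcases hd with rfl | rfl
  · refine ⟨a, b, σ k t₂, σ k t₁, ha, hb, v0 _ s0 s0', v1 _ s1 s1', Or.inr ⟨rfl, rfl⟩, ?_, ?_⟩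
    · rw [q2]; exact v2 _ e₂.1 (by simp [e₂.2])
    · rw [q1]; exact v3 _ (by simp [e₁.1]) e₁.2
  · refine ⟨a, b, σ k t₁, σ k t₂, ha, hb, v0 _ s0 s0', v1 _ s1 s1', Or.inl ⟨rfl, rfl⟩, ?_, ?_⟩
    · rw [q1]; exact v2 _ e₁.1 (by simp [e₁.2])
    · rw [q2]; exact v3 _ (by simp [e₂.1]) e₂.2

end PeanoCurve
end

/-! ### Contradiction for finely divided curves, and repeated subdivision. -/

noncomputable section

namespace PeanoCurve

open Set

/-- The ratio bound read backwards: reaching a distant point takes time. -/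
lemma IsSlowDiagonal.lt_of_le {p : ℝ → Plane} (hp : IsSlowDiagonal p) {s t d : ℝ}
    (hs : s ∈ Icc (0 : ℝ) 1) (ht : t ∈ Icc (0 : ℝ) 1) (hd : 0 < d)
    (h : d ≤ (p t 0 - p s 0) ^ 2 + (p t 1 - p s 1) ^ 2) : d / 5 < |t - s| := by
  have h1 : (p t 0 - p s 0) ^ 2 + (p t 1 - p s 1) ^ 2 = ‖p t - p s‖ ^ 2 := by
    rw [norm_sq_eq]; simp
  rcases lt_trichotomy s t with hlt | rfl | hlt
  · rw [abs_of_pos (by linarith)]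
    linarith [hp.ratio s hs t ht hlt]
  · simp at h; linarith
  · rw [abs_of_neg (by linarith)]
    have := hp.ratio t ht s hs hlt
    rw [norm_sub_rev] at this
    linarith

lemma flip_bounds {f : ℝ → ℝ} (hf : f = (fun s => s) ∨ f = fun s => 1 - s) {s : ℝ}
    (h1 : 1 / 5 < s) (h2 : s < 4 / 5) : 1 / 5 < f s ∧ f s < 4 / 5 := by
  rcases hf with rfl | rfl
  · exact ⟨h1, h2⟩
  · constructor <;> linarith

lemma flip_abs_sub {f : ℝ → ℝ} (hf : f = (fun s => s) ∨ f = fun s => 1 - s) (s t : ℝ) :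
    |f s - f t| = |s - t| := by
  rcases hf with rfl | rfl
  · rfl
  · rw [abs_sub_comm s t]; congr 1; ring

/-- Between moments of a curve of ratio less than `5`, in units of the grid of mesh `ε`. -/
lemma IsSlowDiagonal.grid_ratio {p : ℝ → Plane} (hp : IsSlowDiagonal p) {M : ℕ} {ε : ℝ}
    (hε : M * ε ^ 2 = 1) (r : Fin 2) {k l : ℕ} (hkl : k < l) (hl : l < M) {s t : ℝ}
    (hs : s ∈ Ioo (0 : ℝ) 1) (ht : t ∈ Ioo (0 : ℝ) 1) {a b : ℤ}
    (h1 : p ((k + s) / M) r = ε * a) (h2 : p ((l + t) / M) r = ε * b) :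
    ((b - a : ℤ) : ℝ) ^ 2 < 5 * (l - k + t - s) := by
  have hM : (0 : ℝ) < M := by exact_mod_cast (by omega : 0 < M)
  have hkl' : (k : ℝ) + 1 ≤ l := by exact_mod_cast hkl
  have h3 := hp.ratio _ (moment_mem (hkl.trans hl) (Ioo_subset_Icc_self hs)) _
    (moment_mem hl (Ioo_subset_Icc_self ht))
    (div_lt_div_of_pos_right (by linarith [hs.2, ht.1]) hM)
  have h4 : (ε * b - ε * a) ^ 2 ≤ ‖p ((l + t) / M) - p ((k + s) / M)‖ ^ 2 := by
    rw [norm_sq_eq, ← h1, ← h2]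
    simp only [PiLp.sub_apply]
    fin_cases r
    · exact le_add_of_nonneg_right (sq_nonneg _)
    · exact le_add_of_nonneg_left (sq_nonneg _)
  have h5 := h4.trans_lt h3
  rw [← sub_div, ← mul_div_assoc, lt_div_iff₀ hM] at h5
  push_cast
  nlinarith

/-- A curve of ratio less than `5` is not divided into many pieces of equal length. -/
theorem IsSlowDiagonal.not_hasPiece {p : ℝ → Plane} (hp : IsSlowDiagonal p) {M : ℕ} (hM : 400 ≤ M)
    (h : ∀ k < M, HasPiece p (k / M) (1 / M)) : False := by
  obtain ⟨σ, A, hS, hT⟩ := exists_isPieceSystem hp.image (by omega) h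
  obtain ⟨m, i, j, hm, hmM, hA, hsurj, hinj⟩ := hT.grid
  have hε := hT.pos
  have hεM := hT.area
  set ε := Real.sqrt (1 / M)
  obtain ⟨c, hc, h00, h01, h10, h11⟩ := hS.exists_corner hε hm (fun k hk => ⟨(hA k hk).1,
    (hA k hk).2.1⟩) (fun k hk => (hA k hk).2.2) hinj (by omega) hp
  obtain ⟨t₁, ht₁, e₁⟩ : !₂[(1 : ℝ), 0] ∈ p '' Icc 0 1 := by
    rw [hp.image]; intro r; fin_cases r <;> simp
  obtain ⟨t₂, ht₂, e₂⟩ : !₂[(0 : ℝ), 1] ∈ p '' Icc 0 1 := by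
    rw [hp.image]; intro r; fin_cases r <;> simp
  have e10 : p t₁ 0 = 1 := by rw [e₁]; rfl
  have e11 : p t₁ 1 = 0 := by rw [e₁]; rfl
  have e20 : p t₂ 0 = 0 := by rw [e₂]; rfl
  have e21 : p t₂ 1 = 1 := by rw [e₂]; rfl
  have i0 : (0 : ℝ) ∈ Icc (0 : ℝ) 1 := by simp
  have i1 : (1 : ℝ) ∈ Icc (0 : ℝ) 1 := by simp
  -- Each of the two remaining corners is at distance 1 from both ends of the curve, and they are at
  -- squared distance 2 from each other.
  have b₁ : 1 / 5 < t₁ ∧ t₁ < 4 / 5 := by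
    have h1 := hp.lt_of_le i0 ht₁ one_pos (by
      rw [h00, h01, e10, e11]; rcases hc with rfl | rfl <;> norm_num)
    have h2 := hp.lt_of_le ht₁ i1 one_pos (by
      rw [h10, h11, e10, e11]; rcases hc with rfl | rfl <;> norm_num)
    rw [abs_of_nonneg (by linarith [ht₁.1])] at h1
    rw [abs_of_nonneg (by linarith [ht₁.2])] at h2
    constructor <;> linarith
  have b₂ : 1 / 5 < t₂ ∧ t₂ < 4 / 5 := by
    have h1 := hp.lt_of_le i0 ht₂ one_pos (by
      rw [h00, h01, e20, e21]; rcases hc with rfl | rfl <;> norm_num)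
    have h2 := hp.lt_of_le ht₂ i1 one_pos (by
      rw [h10, h11, e20, e21]; rcases hc with rfl | rfl <;> norm_num)
    rw [abs_of_nonneg (by linarith [ht₂.1])] at h1
    rw [abs_of_nonneg (by linarith [ht₂.2])] at h2
    constructor <;> linarith
  have b₁₂ : 2 / 5 < |t₁ - t₂| :=
    hp.lt_of_le ht₂ ht₁ two_pos (by rw [e10, e11, e20, e21]; norm_num)
  choose! a b w z ha hb hstart hend hwz hw hz using fun k (hk : k < M) =>
    hS.cell hk (hA k hk).2.2 hc h00 h01 h10 h11 ht₁ ht₂ ⟨e10, e11⟩ ⟨e20, e21⟩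
  have hwb : ∀ k < M, 1 / 5 < w k ∧ w k < 4 / 5 := by
    intro k hk
    rcases hwz k hk with ⟨h1, -⟩ | ⟨h1, -⟩ <;> rw [h1]
    · exact flip_bounds (hS.flip k hk) b₁.1 b₁.2
    · exact flip_bounds (hS.flip k hk) b₂.1 b₂.2
  have hzb : ∀ k < M, 1 / 5 < z k ∧ z k < 4 / 5 := by
    intro k hk
    rcases hwz k hk with ⟨-, h1⟩ | ⟨-, h1⟩ <;> rw [h1]
    · exact flip_bounds (hS.flip k hk) b₂.1 b₂.2
    · exact flip_bounds (hS.flip k hk) b₁.1 b₁.2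
  have hwz' : ∀ k < M, 2 / 5 < |w k - z k| := by
    intro k hk
    rcases hwz k hk with ⟨h1, h2⟩ | ⟨h1, h2⟩ <;> rw [h1, h2, flip_abs_sub (hS.flip k hk)]
    · exact b₁₂
    · rwa [abs_sub_comm]
  have hI : ∀ {s : ℝ}, 1 / 5 < s ∧ s < 4 / 5 → s ∈ Ioo (0 : ℝ) 1 := fun h =>
    ⟨by linarith [h.1], by linarith [h.2]⟩
  have hv : ∀ k ≤ M, ∃ x y : ℤ, p (k / M) 0 = ε * x ∧ p (k / M) 1 = ε * y := by
    intro k hk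
    rcases hk.lt_or_eq with hk | rfl
    · have := hstart k hk
      rw [add_zero] at this
      exact ⟨i k + a k, j k + b k, by push_cast; exact this.1, by push_cast; exact this.2⟩
    · obtain ⟨n, rfl⟩ : ∃ n, k = n + 1 := ⟨k - 1, by omega⟩
      have := hend n (by omega)
      refine ⟨i n + 1 - a n, j n + 1 - b n, ?_, ?_⟩
      · push_cast at this ⊢; exact this.1
      · push_cast at this ⊢; exact this.2
  choose! x y hx hy using hv
  have can : ∀ {u v : ℤ}, ε * u = ε * v → u = v := fun h => by
    exact_mod_cast mul_left_cancel₀ hε.ne' h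
  have X0 : ∀ k < M, x k = i k + a k := fun k hk => can (by
    rw [← hx k hk.le]; have := (hstart k hk).1; rw [add_zero] at this; rw [this]; push_cast; rfl)
  have Y0 : ∀ k < M, y k = j k + b k := fun k hk => can (by
    rw [← hy k hk.le]; have := (hstart k hk).2; rw [add_zero] at this; rw [this]; push_cast; rfl)
  have X1 : ∀ k < M, x (k + 1) = i k + 1 - a k := fun k hk => can (by
    rw [← hx (k + 1) hk]; push_cast; exact (hend k hk).1)
  have Y1 : ∀ k < M, y (k + 1) = j k + 1 - b k := fun k hk => can (by
    rw [← hy (k + 1) hk]; push_cast; exact (hend k hk).2)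
  -- From moment w of step k to moment z of step l, the abscissa covers the full extent from x k to
  -- x (l + 1) in the least time; for ordinates w and z exchange roles.
  have hw0 : ∀ k < M, p ((k + w k) / M) 0 = ε * x k := fun k hk => by
    rw [(hw k hk).1, X0 k hk]; push_cast; rfl
  have hw1 : ∀ k < M, p ((k + w k) / M) 1 = ε * y (k + 1) := fun k hk => by
    rw [(hw k hk).2, Y1 k hk]; push_cast; rfl
  have hz0 : ∀ k < M, p ((k + z k) / M) 0 = ε * x (k + 1) := fun k hk => by
    rw [(hz k hk).1, X1 k hk]; push_cast; rfl
  have hz1 : ∀ k < M, p ((k + z k) / M) 1 = ε * y k := fun k hk => by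
    rw [(hz k hk).2, Y0 k hk]; push_cast; rfl
  have hm20 : 20 ≤ m := by nlinarith
  have memZ : ∀ {s : ℝ} {u : ℤ}, s ∈ Icc (0 : ℝ) 1 → s = ε * u → 0 ≤ u ∧ u ≤ m := by
    intro s u hs hsu
    rw [hsu] at hs
    have h1 : (0 : ℝ) ≤ u := nonneg_of_mul_nonneg_right hs.1 hε
    have h2 : (u : ℝ) ≤ m := by
      refine le_of_mul_le_mul_left ?_ hε
      rw [mul_comm ε (m : ℝ), hm]
      exact hs.2
    exact ⟨by exact_mod_cast h1, by exact_mod_cast h2⟩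
  have hM0 : (0 : ℝ) < M := by exact_mod_cast (by omega : 0 < M)
  have timeI : ∀ k ≤ M, (k / M : ℝ) ∈ Icc (0 : ℝ) 1 := fun k hk =>
    ⟨by positivity, (div_le_one hM0).2 (by exact_mod_cast hk)⟩
  have hP0 : p ((0 : ℕ) / M) = p 0 := by simp
  have hPM : p ((M : ℕ) / M) = p 1 := by rw [div_self hM0.ne']
  have vx0 := hx 0 (by omega)
  have vy0 := hy 0 (by omega)
  have vxM := hx M le_rfl
  have vyM := hy M le_rfl
  rw [hP0] at vx0 vy0
  rw [hPM] at vxM vyM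
  have zero : ∀ {u : ℤ}, (0 : ℝ) = ε * u → u = 0 := fun h => can (by simpa using h.symm)
  have one : ∀ {u : ℤ}, (1 : ℝ) = ε * u → u = m := fun h => can (by
    rw [← h, ← hm]; push_cast; ring)
  refine GridPath.no_timed_path (m := m) (M := M) (x := x) (y := y) (w := w) (z := z)
    (fun k hk => ?_) (fun k hk => ?_) (fun k hk => memZ (hp.mem (timeI k hk) 0) (hx k hk))
    (fun k hk => memZ (hp.mem (timeI k hk) 1) (hy k hk)) (fun k hk l hl h1 h2 => ?_) hwb hzb hwz'
    (fun k l hkl hl => hp.grid_ratio hεM 0 hkl hl (hI (hwb k (hkl.trans hl))) (hI (hzb l hl))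
      (hw0 k (hkl.trans hl)) (hz0 l hl))
    (fun k l hkl hl => hp.grid_ratio hεM 1 hkl hl (hI (hzb k (hkl.trans hl))) (hI (hwb l hl))
      (hz1 k (hkl.trans hl)) (hw1 l hl)) ?_ ?_ ?_ (by exact_mod_cast hm20)
  · have := X0 k hk; have := X1 k hk; have := ha k hk
    omega
  · have := Y0 k hk; have := Y1 k hk; have := hb k hk
    omega
  · have := X0 k hk; have := X1 k hk; have := Y0 k hk; have := Y1 k hk
    have := X0 l hl; have := X1 l hl; have := Y0 l hl; have := Y1 l hl
    exact hinj k hk l hl (by omega) (by omega)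
  · rcases hc with rfl | rfl
    · rw [h00] at vx0; rw [h01] at vy0; rw [h10, sub_zero] at vxM; rw [h11, sub_zero] at vyM
      exact Or.inl ⟨zero vx0, zero vy0, one vxM, one vyM⟩
    · rw [h00] at vx0; rw [h01] at vy0; rw [h10, sub_self] at vxM; rw [h11, sub_self] at vyM
      exact Or.inr ⟨one vx0, one vy0, zero vxM, zero vyM⟩
  · obtain ⟨k, hk, h1, h2⟩ := hsurj (m - 1) (by omega) 0 (by omega)
    refine ⟨k, hk, ?_, ?_⟩
    · rw [X0 k hk, X1 k hk]; omega
    · rw [Y0 k hk, Y1 k hk]; omega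
  · obtain ⟨k, hk, h1, h2⟩ := hsurj 0 (by omega) (m - 1) (by omega)
    refine ⟨k, hk, ?_, ?_⟩
    · rw [X0 k hk, X1 k hk]; omega
    · rw [Y0 k hk, Y1 k hk]; omega

lemma simMap_simMap (v v' : Plane) (ε ε' : ℝ) (L L' : Plane ≃ₗᵢ[ℝ] Plane) (q : Plane) :
    simMap v ε L (simMap v' ε' L' q) = simMap (v + ε • L v') (ε * ε') (L'.trans L) q := by
  simp [simMap, mul_smul, add_assoc]

/-- A piece of a piece is a piece, because similarities compose and the factors √l multiply. -/
lemma hasPiece_pow {p : ℝ → Plane} {N : ℕ} (hN : 0 < N) (h : ∀ k < N, HasPiece p (k / N) (1 / N))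
    (n : ℕ) : ∀ k < N ^ n, HasPiece p (k / (N ^ n : ℕ)) (1 / (N ^ n : ℕ)) := by
  have hN' : (0 : ℝ) < N := by exact_mod_cast hN
  induction n with
  | zero =>
    intro k hk
    obtain rfl : k = 0 := by simpa using hk
    exact ⟨fun s => s, Or.inl rfl, 0, LinearIsometryEquiv.refl ℝ _, by simp [simMap]⟩
  | succ n ih =>
    intro k hk
    set R := N ^ n with hR
    have hR0 : 0 < R := by positivity
    have hR' : (0 : ℝ) < R := by exact_mod_cast hR0
    have hNR : N ^ (n + 1) = R * N := pow_succ N n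
    rw [hNR] at hk ⊢
    obtain ⟨σ, hσ, v, L, hL⟩ := h (k / R) (Nat.div_lt_of_lt_mul hk)
    have hkd : ((k / R : ℕ) : ℝ) = (k - (k % R : ℕ)) / R := by
      rw [eq_div_iff hR'.ne', eq_sub_iff_add_eq]
      exact_mod_cast Nat.div_add_mod' k R
    have hmod : k % R < R := Nat.mod_lt _ hR0
    -- Inside a reversed coarse piece the fine pieces are counted from the other end.
    obtain ⟨r, hr, hrσ⟩ : ∃ r < R, ∀ s, σ ((r + s) / R) = ((k % R : ℕ) + σ s) / R := by
      rcases hσ with rfl | rfl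
      · exact ⟨k % R, hmod, fun s => rfl⟩
      · refine ⟨R - 1 - k % R, by omega, fun s => ?_⟩
        have : ((R - 1 - k % R : ℕ) : ℝ) = R - 1 - (k % R : ℕ) := by
          rw [Nat.cast_sub (by omega), Nat.cast_sub (by omega), Nat.cast_one]
        rw [this]
        field_simp
        ring
    obtain ⟨τ, hτ, v', L', hL'⟩ := ih r hr
    refine ⟨fun s => σ (τ s), ?_, v + Real.sqrt (1 / N) • L v', L'.trans L, fun s hs => ?_⟩
    · rcases hσ with rfl | rfl <;> rcases hτ with rfl | rfl <;> simp
    · have h1 := flip_mem hτ hs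
      have h2 : Real.sqrt (1 / (R * N : ℕ)) = Real.sqrt (1 / N) * Real.sqrt (1 / R) := by
        rw [← Real.sqrt_mul (by positivity)]
        congr 1
        push_cast
        field_simp
      rw [h2, ← simMap_simMap, ← hL' s hs, ← hL]
      · congr 1
        have h3 : (r : ℝ) / R + 1 / R * τ s = (r + τ s) / R := by ring
        rw [h3, hrσ, hkd]
        push_cast
        field_simp
        ring
      · have h3 : (r : ℝ) / R + 1 / R * τ s = (r + τ s) / R := by ring
        rw [h3]
        exact moment_mem hr h1

/-- A curve of ratio less than `5` is not divided into two or more pieces of equal length. -/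
theorem IsSlowDiagonal.false {p : ℝ → Plane} (hp : IsSlowDiagonal p) {N : ℕ} (hN : 2 ≤ N)
    (h : ∀ k < N, HasPiece p (k / N) (1 / N)) : False :=
  -- The exponent 9 suffices because 2⁹ = 512 ≥ 400.
  hp.not_hasPiece (M := N ^ 9)
    (le_trans (by norm_num) (Nat.pow_le_pow_left hN 9)) (hasPiece_pow (by omega) h 9)

end PeanoCurve
end

/-! ### Reduction of a general curve to a normalized one. -/

noncomputable section

namespace PeanoCurve

open MeasureTheory Set

lemma exists_eq_simMap (φ : Plane ≃ᵢ Plane) :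
    ∃ (v : Plane) (L : Plane ≃ₗᵢ[ℝ] Plane), ∀ q, φ q = simMap v 1 L q :=
  ⟨φ 0, φ.toRealLinearIsometryEquiv, fun q => by
    simp [simMap, IsometryEquiv.toRealLinearIsometryEquiv_apply]⟩

lemma smul_eq_simMap (s : ℝ) (q : Plane) :
    s • q = simMap 0 s (LinearIsometryEquiv.refl ℝ Plane) q := by
  simp [simMap]

lemma isometryEquiv_real (h : ℝ ≃ᵢ ℝ) : (∀ x, h x = h 0 + x) ∨ ∀ x, h x = h 0 - x := by
  have h1 : ∀ x, h x = h 0 + x * h.toRealLinearIsometryEquiv 1 := by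
    intro x
    have h2 : h.toRealLinearIsometryEquiv x = x * h.toRealLinearIsometryEquiv 1 := by
      have := h.toRealLinearIsometryEquiv.map_smul x 1
      simpa using this
    rw [← h2, IsometryEquiv.toRealLinearIsometryEquiv_apply]
    ring
  have h3 : |h.toRealLinearIsometryEquiv 1| = 1 := by
    have := h.toRealLinearIsometryEquiv.norm_map 1
    simpa using this
  rcases eq_or_eq_neg_of_abs_eq h3 with h4 | h4
  · exact Or.inl fun x => by rw [h1, h4]; ring
  · exact Or.inr fun x => by rw [h1, h4]; ring

/-- Similar curves in coordinates: up to reversal, they differ by a similarity of the plane. -/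
lemma Curve.IsSimilar.exists_simMap {F G : Curve} (h : F.IsSimilar G) :
    ∃ k : ℝ, 0 < k ∧ k * (F.b - F.a) = G.b - G.a ∧ ∃ σ : ℝ → ℝ,
      (σ = (fun s => s) ∨ σ = fun s => 1 - s) ∧ ∃ (v : Plane) (L : Plane ≃ₗᵢ[ℝ] Plane),
      ∀ t ∈ Icc (0 : ℝ) 1, G.toFun (G.a + (G.b - G.a) * σ t) =
        simMap v (Real.sqrt k) L (F.toFun (F.a + (F.b - F.a) * t)) := by
  obtain ⟨k, hk, h, h', hdom, heq⟩ := h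
  obtain ⟨v, L, hL⟩ := exists_eq_simMap h'
  have hab := F.a_lt_b
  have hGab := G.a_lt_b
  simp only [Curve.domain, Curve.rescale] at hdom heq
  have hkab : k * F.a ≤ k * F.b := mul_le_mul_of_nonneg_left hab.le hk.le
  have ma : h (k * F.a) ∈ Icc G.a G.b := hdom ▸ mem_image_of_mem h (left_mem_Icc.2 hkab)
  have mb : h (k * F.b) ∈ Icc G.a G.b := hdom ▸ mem_image_of_mem h (right_mem_Icc.2 hkab)
  obtain ⟨c, hc, ec⟩ : G.a ∈ h '' Icc (k * F.a) (k * F.b) := hdom ▸ left_mem_Icc.2 hGab.le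
  obtain ⟨d, hd, ed⟩ : G.b ∈ h '' Icc (k * F.a) (k * F.b) := hdom ▸ right_mem_Icc.2 hGab.le
  have main : ∀ t ∈ Icc (0 : ℝ) 1, G.toFun (h (k * (F.a + (F.b - F.a) * t))) =
      simMap v (Real.sqrt k) L (F.toFun (F.a + (F.b - F.a) * t)) := by
    intro t ht
    rw [← heq _ ⟨mul_le_mul_of_nonneg_left (by nlinarith [ht.1]) hk.le,
      mul_le_mul_of_nonneg_left (by nlinarith [ht.2]) hk.le⟩, mul_div_cancel_left₀ _ hk.ne', hL]
    simp [simMap]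
  rcases isometryEquiv_real h with hh | hh
  · rw [hh] at ma mb ec ed
    have ea : h 0 + k * F.a = G.a := le_antisymm (by linarith [hc.1]) ma.1
    have eb : h 0 + k * F.b = G.b := le_antisymm mb.2 (by linarith [hd.2])
    refine ⟨k, hk, by linarith, fun s => s, Or.inl rfl, v, L, fun t ht => ?_⟩
    rw [← main t ht, hh]
    congr 1
    rw [← ea, ← eb]
    ring
  · rw [hh] at ma mb ec ed
    have ea : h 0 - k * F.b = G.a := le_antisymm (by linarith [hc.2]) mb.1
    have eb : h 0 - k * F.a = G.b := le_antisymm ma.2 (by linarith [hd.1])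
    refine ⟨k, hk, by linarith, fun s => 1 - s, Or.inr rfl, v, L, fun t ht => ?_⟩
    rw [← main t ht, hh]
    congr 1
    rw [← ea, ← eb]
    ring

lemma Curve.image_eq (F : Curve) {σ : ℝ → ℝ} (hσ : σ = (fun s => s) ∨ σ = fun s => 1 - s) :
    F.image = (fun t => F.toFun (F.a + (F.b - F.a) * σ t)) '' Icc 0 1 := by
  have hab := F.a_lt_b
  ext q
  constructor
  · rintro ⟨t, ht, rfl⟩
    have hs : (t - F.a) / (F.b - F.a) ∈ Icc (0 : ℝ) 1 := by
      rw [mem_Icc, div_le_one (by linarith)]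
      exact ⟨div_nonneg (by linarith [ht.1]) (by linarith), by linarith [ht.2]⟩
    refine ⟨_, flip_mem hσ hs, ?_⟩
    simp only [flip_flip hσ]
    congr 1
    rw [mul_div_cancel₀ _ (by linarith : F.b - F.a ≠ 0)]
    ring
  · rintro ⟨s, hs, rfl⟩
    have := flip_mem hσ hs
    exact ⟨_, ⟨by nlinarith [this.1], by nlinarith [this.2]⟩, rfl⟩

lemma mem_coordSquare_smul {s : ℝ} (hs : 0 < s) (q : Plane) :
    s • q ∈ coordSquare s ↔ q ∈ coordSquare 1 := by
  refine forall_congr' fun r => ?_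
  simp only [PiLp.smul_apply, smul_eq_mul, mem_Icc]
  constructor
  · exact fun h => ⟨nonneg_of_mul_nonneg_right h.1 hs, by nlinarith [h.2]⟩
  · exact fun h => ⟨by nlinarith [h.1], by nlinarith [h.2]⟩

lemma coordSquare_eq_image {s : ℝ} (hs : 0 < s) : coordSquare s = (s • ·) '' coordSquare 1 := by
  ext q
  constructor
  · intro h
    refine ⟨s⁻¹ • q, ?_, smul_inv_smul₀ hs.ne' q⟩
    rwa [← mem_coordSquare_smul hs, smul_inv_smul₀ hs.ne']
  · rintro ⟨q, hq, rfl⟩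
    exact (mem_coordSquare_smul hs q).2 hq

lemma volume_square (φ : Plane ≃ᵢ Plane) {s : ℝ} (hs : 0 < s) :
    volume (φ '' coordSquare s) = ENNReal.ofReal (s ^ 2) * volume (coordSquare 1) := by
  obtain ⟨v, L, h⟩ := exists_eq_simMap φ
  rw [coordSquare_eq_image hs, image_image]
  simp only [h, smul_eq_simMap, simMap_simMap]
  rw [volume_simMap_image, one_mul]

/-- A curve similar to a unit Peano curve has duration equal to the area of its square. -/
lemma Curve.sq_side_eq {F U : Curve} (hU : U.IsUnitPeano) (hFU : F.IsSimilar U) {s : ℝ}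
    (hs : 0 < s) {φ : Plane ≃ᵢ Plane} (hF : F.image = φ '' coordSquare s) : s ^ 2 = F.b - F.a := by
  obtain ⟨ha, hb, -, ψ, hψ⟩ := hU
  obtain ⟨k, hk, hkl, σ, hσ, v, L, hL⟩ := hFU.exists_simMap
  have h1 : U.image = simMap v (Real.sqrt k) L '' F.image := by
    rw [U.image_eq hσ, F.image_eq (Or.inl rfl), image_image]
    exact image_congr hL
  -- Similarity with coefficient k multiplies both area and duration by k, and for the unit curve
  -- they agree.
  have h2 := congrArg volume h1
  rw [hψ, volume_square ψ one_pos, volume_simMap_image, hF, volume_square φ hs, ← mul_assoc,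
    ENNReal.mul_left_inj volume_coordSquare_ne_zero volume_coordSquare_ne_top,
    ← ENNReal.ofReal_mul (by positivity), Real.sq_sqrt hk.le,
    ENNReal.ofReal_eq_ofReal_iff (by positivity) (by positivity)] at h2
  rw [ha, hb] at hkl
  have h3 : k * s ^ 2 = k * (F.b - F.a) := by rw [hkl, ← h2]; norm_num
  exact mul_left_cancel₀ hk.ne' h3

lemma IsRegularPartition.exists_eq {P : Set (ℝ × ℝ)} {a b : ℝ} (hab : a < b)
    (h : IsRegularPartition P a b) : ∃ (N : ℕ) (l : ℝ), N * l = b - a ∧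
      ∀ k < N, (a + k * l, a + (k + 1) * l) ∈ P := by
  obtain ⟨hfin, ⟨l, hl, hP⟩, hU, hd⟩ := h
  have hcov : ∀ t ∈ Icc a b, ∃ I ∈ P, t ∈ Icc I.1 I.2 := by
    intro t ht
    rw [← hU] at ht
    obtain ⟨I, hI, h⟩ := mem_iUnion₂.1 ht
    exact ⟨I, hI, h⟩
  have hsub : ∀ I ∈ P, a ≤ I.1 ∧ I.2 ≤ b := by
    intro I hI
    have h1 : Icc I.1 I.2 ⊆ Icc a b := hU ▸ subset_biUnion_of_mem (u := fun I : ℝ × ℝ => Icc I.1 I.2) hI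
    have h2 : I.1 ≤ I.2 := by linarith [hP I hI]
    exact ⟨(h1 (left_mem_Icc.2 h2)).1, (h1 (right_mem_Icc.2 h2)).2⟩
  have step : ∀ x, a ≤ x → x < b → (x = a ∨ (x - l, x) ∈ P) → (x, x + l) ∈ P := by
    intro x hax hxb hx
    -- The leftmost segment ending after x must start at x: a gap before it would be covered by a
    -- segment further left, and an earlier start would leave [a, b] or overlap the preceding
    -- segment.
    obtain ⟨I, ⟨hI, hxI⟩, hmin⟩ := exists_min_image {I ∈ P | x < I.2} Prod.fst
      (hfin.subset fun I hI => hI.1) (by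
        obtain ⟨I, hI, h1⟩ := hcov b (right_mem_Icc.2 hab.le)
        exact ⟨I, hI, hxb.trans_le h1.2⟩)
    have hIl := hP I hI
    have h1 : I.1 ≤ x := by
      by_contra! h1
      obtain ⟨J, hJ, hJm⟩ := hcov ((x + I.1) / 2) ⟨by linarith, by linarith [(hsub I hI).2]⟩
      have := hmin J ⟨hJ, by linarith [hJm.2]⟩
      linarith [hJm.1]
    have h2 : x ≤ I.1 := by
      rcases hx with rfl | hx
      · exact (hsub I hI).1
      by_contra! h2
      have hne : I ≠ (x - l, x) := fun e => by rw [e] at hxI; exact lt_irrefl _ hxI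
      have hm : max I.1 (x - l) < x := max_lt h2 (by linarith)
      have hdis : Disjoint (Ioo I.1 I.2) (Ioo (x - l) x) := hd hI hx hne
      refine hdis.notMem_of_mem_left (a := (max I.1 (x - l) + x) / 2) ⟨?_, ?_⟩ ⟨?_, ?_⟩
      · linarith [le_max_left I.1 (x - l)]
      · linarith
      · linarith [le_max_right I.1 (x - l)]
      · linarith
    have h3 : I = (x, x + l) := Prod.ext (le_antisymm h1 h2) (by change I.2 = x + l; linarith)
    exact h3 ▸ hI
  have key : ∀ k : ℕ, a + k * l < b → (a + k * l, a + (k + 1) * l) ∈ P := by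
    intro k
    induction k with
    | zero =>
      intro _
      simpa using step a le_rfl hab (Or.inl rfl)
    | succ k ih =>
      intro hk
      push_cast at hk ⊢
      have h1 := ih (by linarith)
      have h2 := step (a + (k + 1) * l) (by nlinarith [Nat.cast_nonneg (α := ℝ) k]) hk
        (Or.inr (by convert h1 using 2; ring))
      convert h2 using 2
      ring
  refine ⟨⌈(b - a) / l⌉₊, l, le_antisymm ?_ ((div_le_iff₀ hl).1 (Nat.le_ceil _)), fun k hk => key k ?_⟩
  · have hpos : 0 < ⌈(b - a) / l⌉₊ := Nat.ceil_pos.2 (div_pos (by linarith) hl)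
    have h1 := Nat.lt_ceil.1 (show ⌈(b - a) / l⌉₊ - 1 < ⌈(b - a) / l⌉₊ by omega)
    rw [lt_div_iff₀ hl] at h1
    have h2 := (hsub _ (key (⌈(b - a) / l⌉₊ - 1) (by linarith))).2
    have h3 : ((⌈(b - a) / l⌉₊ - 1 : ℕ) + 1 : ℝ) = ⌈(b - a) / l⌉₊ := by exact_mod_cast (by omega)
    simp only [h3] at h2
    linarith
  · have h1 := Nat.lt_ceil.1 hk
    rw [lt_div_iff₀ hl] at h1
    linarith

/-- A fractal period gives a piece of the normalized curve. -/
lemma Curve.IsPeriod.hasPiece {F : Curve} {c d : ℝ} (h : F.IsPeriod c d) {s : ℝ} (hs : 0 < s)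
    (φ : Plane ≃ᵢ Plane) :
    HasPiece (fun t => s⁻¹ • φ.symm (F.toFun (F.a + (F.b - F.a) * t)))
      ((c - F.a) / (F.b - F.a)) ((d - c) / (F.b - F.a)) := by
  obtain ⟨hac, hcd, hdb, hsim⟩ := h
  obtain ⟨k, hk, hkl, σ, hσ, v, L, hL⟩ := hsim.exists_simMap
  have hab : F.b - F.a ≠ 0 := (sub_pos.2 F.a_lt_b).ne'
  change k * (F.b - F.a) = d - c at hkl
  change ∀ t ∈ Icc (0 : ℝ) 1, F.toFun (c + (d - c) * σ t) = _ at hL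
  obtain ⟨v₁, L₁, h₁⟩ := exists_eq_simMap φ
  obtain ⟨v₂, L₂, h₂⟩ := exists_eq_simMap φ.symm
  refine ⟨σ, hσ, ?_⟩
  rw [← hkl, mul_div_cancel_right₀ _ hab]
  -- The similarity of the period is conjugated by the normalization of the square, which leaves its
  -- factor √k unchanged.
  have key : ∀ t ∈ Icc (0 : ℝ) 1,
      s⁻¹ • φ.symm (F.toFun (F.a + (F.b - F.a) * ((c - F.a) / (F.b - F.a) + k * σ t))) =
      s⁻¹ • φ.symm (simMap v (Real.sqrt k) L
        (φ (s • s⁻¹ • φ.symm (F.toFun (F.a + (F.b - F.a) * t))))) := by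
    intro t ht
    rw [smul_inv_smul₀ hs.ne', φ.apply_symm_apply, ← hL t ht]
    have e : F.a + (F.b - F.a) * ((c - F.a) / (F.b - F.a) + k * σ t) = c + (d - c) * σ t := by
      rw [← hkl]
      field_simp
      ring
    rw [e]
  simp only [h₁, h₂ (simMap _ _ _ _), smul_eq_simMap s, smul_eq_simMap s⁻¹ (simMap _ _ _ _),
    simMap_simMap] at key
  rw [show s⁻¹ * (1 * (Real.sqrt k * (1 * s))) = Real.sqrt k by field_simp] at key
  exact ⟨_, _, key⟩

/-- Since s² equals the duration, squared distances and times are divided by the same number, and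
the ratio is preserved. -/
lemma Curve.isSlowDiagonal {F : Curve} (h5 : F.squareToLinearRatio < 5) {s : ℝ} (hs : 0 < s)
    {φ : Plane ≃ᵢ Plane} (hF : F.image = φ '' coordSquare s) (hs2 : s ^ 2 = F.b - F.a)
    (ha : F.toFun F.a ∈ φ '' coordDiagonal s) (hb : F.toFun F.b ∈ φ '' coordDiagonal s) :
    IsSlowDiagonal fun t => s⁻¹ • φ.symm (F.toFun (F.a + (F.b - F.a) * t)) := by
  have hab := F.a_lt_b
  have hdiag : ∀ q ∈ φ '' coordDiagonal s, (s⁻¹ • φ.symm q) 0 = (s⁻¹ • φ.symm q) 1 := by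
    rintro _ ⟨q, hq, rfl⟩
    simp [hq.2]
  refine ⟨?_, ?_, ?_, ?_⟩
  · have h1 : (fun t => s⁻¹ • φ.symm (F.toFun (F.a + (F.b - F.a) * t))) '' Icc 0 1 =
        (fun q => s⁻¹ • φ.symm q) '' F.image := by
      rw [F.image_eq (Or.inl rfl), image_image]
    rw [h1, hF, coordSquare_eq_image hs, image_image, image_image]
    simp [inv_smul_smul₀ hs.ne']
  · simpa using hdiag _ ha
  · simpa using hdiag _ hb
  · intro t ht t' ht' htt
    have m1 : F.a + (F.b - F.a) * t ∈ F.domain := ⟨by nlinarith [ht.1], by nlinarith [ht.2]⟩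
    have m2 : F.a + (F.b - F.a) * t' ∈ F.domain := ⟨by nlinarith [ht'.1], by nlinarith [ht'.2]⟩
    have hlt : F.a + (F.b - F.a) * t < F.a + (F.b - F.a) * t' := by nlinarith
    have h1 : ENNReal.ofReal (‖F.toFun (F.a + (F.b - F.a) * t') -
        F.toFun (F.a + (F.b - F.a) * t)‖ ^ 2 /
          |F.a + (F.b - F.a) * t' - (F.a + (F.b - F.a) * t)|) < 5 := by
      refine lt_of_le_of_lt ?_ h5
      unfold Curve.squareToLinearRatio
      exact le_iSup₂_of_le _ m2 (le_iSup₂_of_le _ m1 (le_iSup_of_le hlt.ne' le_rfl))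
    have h2 := (ENNReal.ofReal_lt_iff_lt_toReal (by positivity) (by norm_num)).1 h1
    rw [abs_of_pos (by linarith), div_lt_iff₀ (by linarith), ENNReal.toReal_ofNat] at h2
    rw [← smul_sub, norm_smul, ← dist_eq_norm (φ.symm _), φ.symm.dist_eq, dist_eq_norm, mul_pow,
      norm_inv, Real.norm_of_nonneg hs.le, inv_pow, hs2, inv_mul_lt_iff₀ (by linarith)]
    linarith

end PeanoCurve

end

theorem mainTheorem2 (F : PeanoCurve.Curve) (hreg : F.IsRegularPeano) (hdiag : F.IsDiagonal)
    (hunit : ∃ U : PeanoCurve.Curve, U.IsUnitPeano ∧ F.IsSimilar U) :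
    5 ≤ F.squareToLinearRatio := by
  by_contra! h5
  obtain ⟨D, ⟨s, φ, hs, hF, rfl⟩, ha, hb⟩ := hdiag
  obtain ⟨U, hU, hFU⟩ := hunit
  have hab := F.a_lt_b
  have hs2 := PeanoCurve.Curve.sq_side_eq hU hFU hs hF
  have hp := PeanoCurve.Curve.isSlowDiagonal h5 hs hF hs2 ha hb
  obtain ⟨N, l, hNl, hper⟩ := hreg.2.2.exists_eq hab
  -- A single segment would be the whole domain, but maximal periods are proper.
  have hN : 2 ≤ N := by
    by_contra! hN
    interval_cases N
    · simp at hNl; linarith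
    · have h1 := (hper 0 one_pos).1.2
      simp only [Nat.cast_one, one_mul] at hNl
      apply h1
      simp [hNl]
  have hN0 : (0 : ℝ) < N := by exact_mod_cast (by omega : 0 < N)
  have hba : 0 < F.b - F.a := sub_pos.2 hab
  refine hp.false hN fun k hk => ?_
  have h1 := (hper k hk).1.1.hasPiece hs φ
  have e1 : (F.a + k * l - F.a) / (F.b - F.a) = k / N := by
    rw [← hNl] at hba ⊢
    have hl : l ≠ 0 := by rintro rfl; simp at hba
    field_simp
    ring
  have e2 : (F.a + (k + 1) * l - (F.a + k * l)) / (F.b - F.a) = 1 / N := by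
    rw [← hNl] at hba ⊢
    have hl : l ≠ 0 := by rintro rfl; simp at hba
    field_simp
    ring
  simp only [e1, e2] at h1
  exact h1
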